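/- **Definitions.** Let $(X,d)$ be a metric space. For $q\ge 1$, $Q\ge 0$, an *integral $(q,Q)$-quasi-geodesic* is a map $g:(a,b)\cap\mathbb{Z}_+\to X$ (with $b=\infty$ allowed) such that $\frac{|i-j|}{q}-Q\le d(g(i),g(j))\le q|i-j|+Q$ for all $i,j$ in its domain; it originates at $x_0$ if $1$ is in the domain and $g(1)=x_0$, and such a $g$ is a *ray originating at $x_0$* if its domain is all of $\mathbb{Z}_+$. $X$ is *integrally quasi-geodesic* if for some fixed $q\ge1$, $Q\ge0$ any two points of $X$ are joined by an integral $(q,Q)$-quasi-geodesic (every geodesic space is integrally quasi-geodesic). For an integral $(k,k)$-quasi-geodesic ray $g$ originating at $x_0$ and $m\ge1$, the cone $C_X(x_0,k,k,g,m)$ is the set of all points $h(i)$ with $i\ge m$, where $h$ is an integral $(k,k)$-quasi-geodesic originating at $x_0$ with $h(j)=g(j)$ for all $j\le m$. A bounded continuous function $f:X\to\mathbb{C}$ is *geometrically slowly oscillating* if 1. $|f(x_n)-f(y_n)|\to0$ whenever $x_n\to\infty$ and $\sup_n d(x_n,y_n)<\infty$, and 2. for all $\varepsilon>0$, $k\ge1$,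 $x_0\in X$ and every integral $(k,k)$-quasi-geodesic ray $g$ originating at $x_0$ there is $m\ge1$ with $\operatorname{diam} f(C_X(x_0,k,k,g,m))<\varepsilon$. Let $C_{QG}(X)$ be the algebra of all such functions with the sup norm. The *quasi-geodesic compactification* $X_{QG}$ is its space of characters with the weak-$*$ topology, $X$ is mapped to $X_{QG}$ by evaluations, and for proper $X$ the *quasi-geodesic boundary* is $\partial_{QG}X=X_{QG}\setminus X$. Let $\langle x,y\rangle_a=\frac12(d(x,a)+d(y,a)-d(x,y))$. $X$ is *Gromov hyperbolic* if for some $\delta>0$ one has $\langle x,y\rangle_a\ge\min\{\langle x,z\rangle_a,\langle z,y\rangle_a\}-\delta/4$ for all $x,y,z,a\in X$. Its *Gromov boundary* $\partial X$ is the set of sequences $(u_i)$ in $X$ with $\langle u_i,u_j\rangle_a\to\infty$ as $i,j\to\infty$ for every $a\in X$, modulo the relation $(u_i)\sim(v_j)$ iff $\langle u_i,v_j\rangle_a\to\infty$ as $i,j\to\infty$ for every $a\in X$. Extend the Gromov product to $X\cup\partial X$ by $\langle z,w\rangle_a=\inf\liminf_{i,j\to\infty}\langle u_i,v_j\rangle_a$,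 the infimum being over all sequences $u,v$ representing $z,w$ (a point of $X$ is represented by the constant sequence). The *Gromov compactification* is $X\cup\partial X$ with the topology in which $U$ is open iff $U\cap X$ is open in $X$ and for every $\xi\in U\cap\partial X$ and $a\in X$ there is $R\in\mathbb{R}$ with $\{w:\langle\xi,w\rangle_a>R\}\subseteq U$; $\partial X$ has the subspace topology. **Proposition 4.14.** Let $X$ be a proper, integrally quasi-geodesic (for instance, proper geodesic), Gromov hyperbolic metric space. Then the Gromov boundary of $X$ coincides with the quasi-geodesic boundary of $X$: there is a homeomorphism $\Phi:X\cup\partial X\to X_{QG}$ which is the identity on $X$ and restricts to a homeomorphism $\partial X\to\partial_{QG}X$. Moreover, a function $f:X\to\mathbb{C}$ is geometrically slowly oscillating if and only if it is the restriction to $X$ of a continuous function $X\cup\partial X\to\mathbb{C}$. -/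

import Mathlib

open Filter Topology
open scoped BoundedContinuousFunction

noncomputable section

/-! ### Integral quasi-geodesics -/

/-- The sets `(a, b) ∩ ℤ₊`, where `b` may be infinite. -/
def IsIntegralInterval (I : Set ℕ) : Prop :=
  ∃ (a : ℕ) (b : ℕ∞), I = {i : ℕ | a < i ∧ (i : ℕ∞) < b}

/-- `g`, restricted to `I`, is an integral `(q, Q)`-quasi-geodesic with domain `I = (a, b) ∩ ℤ₊`.
The values of `g` outside `I` play no role. -/
def IsIntegralQuasiGeodesic {X : Type*} [MetricSpace X] (q Q : ℝ) (I : Set ℕ) (g : ℕ → X) : Prop :=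
  IsIntegralInterval I ∧
    ∀ i ∈ I, ∀ j ∈ I,
      |(i : ℝ) - (j : ℝ)| / q - Q ≤ dist (g i) (g j) ∧
        dist (g i) (g j) ≤ q * |(i : ℝ) - (j : ℝ)| + Q

/-- Any two points are joined by an integral `(q, Q)`-quasi-geodesic, for some `q ≥ 1`, `Q ≥ 0`
independent of the points. -/
def IsIntegrallyQuasiGeodesic (X : Type*) [MetricSpace X] : Prop :=
  ∃ q Q : ℝ, 1 ≤ q ∧ 0 ≤ Q ∧ ∀ x y : X, ∃ (n : ℕ) (g : ℕ → X), 1 ≤ n ∧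
    IsIntegralQuasiGeodesic q Q (Set.Icc 1 n) g ∧ g 1 = x ∧ g n = y

/-- The fan: `h`, with domain `I`, is an integral `(q, Q)`-quasi-geodesic originating at `x₀`. -/
def InFan {X : Type*} [MetricSpace X] (x₀ : X) (q Q : ℝ) (I : Set ℕ) (h : ℕ → X) : Prop :=
  IsIntegralQuasiGeodesic q Q I h ∧ 1 ∈ I ∧ h 1 = x₀

/-- The thread: members of the fan that are defined and agree with `g` at all indices `i ≤ m`. -/
def InThread {X : Type*} [MetricSpace X] (x₀ : X) (q Q : ℝ) (g : ℕ → X) (m : ℕ)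
    (I : Set ℕ) (h : ℕ → X) : Prop :=
  InFan x₀ q Q I h ∧ ∀ i : ℕ, 1 ≤ i → i ≤ m → i ∈ I ∧ h i = g i

/-- The `m`-cone `C_X(x₀, q, Q, g, m)`: all values `h i`, `i ≥ m`, of members `h` of the
`m`-thread based at `g`. -/
def quasiGeodesicCone {X : Type*} [MetricSpace X] (x₀ : X) (q Q : ℝ) (g : ℕ → X) (m : ℕ) : Set X :=
  {x | ∃ (I : Set ℕ) (h : ℕ → X), InThread x₀ q Q g m I h ∧ ∃ i ∈ I, m ≤ i ∧ h i = x}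

/-- An integral `(q, Q)`-quasi-geodesic ray originating at `x₀`: the domain is all of `ℤ₊`. -/
def IsIntegralQuasiGeodesicRay {X : Type*} [MetricSpace X] (x₀ : X) (q Q : ℝ) (g : ℕ → X) : Prop :=
  InFan x₀ q Q {i : ℕ | 1 ≤ i} g

/-! ### Geometrically slowly oscillating functions -/

def IsSlowlyOscillating {X : Type*} [MetricSpace X] (f : X → ℂ) : Prop :=
  ∀ x y : ℕ → X, Tendsto x atTop (Bornology.cobounded X) →
    (∃ M : ℝ, 0 < M ∧ ∀ n, dist (x n) (y n) < M) →
      Tendsto (fun n => ‖f (x n) - f (y n)‖) atTop (𝓝 0)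

structure IsGeometricallySlowlyOscillating {X : Type*} [MetricSpace X] (f : X → ℂ) : Prop where
  continuous : Continuous f
  bounded : ∃ C : ℝ, ∀ x, ‖f x‖ ≤ C
  slowlyOscillating : IsSlowlyOscillating f
  geometric : ∀ ε : ℝ, 0 < ε → ∀ (k : ℝ) (x₀ : X) (g : ℕ → X), 1 ≤ k →
    IsIntegralQuasiGeodesicRay x₀ k k g →
      ∃ m : ℕ, 1 ≤ m ∧ Metric.diam (f '' quasiGeodesicCone x₀ k k g m) < ε

/-! ### The quasi-geodesic compactification -/

theorem quasiGeodesicCone_anti {X : Type*} [MetricSpace X] (x₀ : X) (q Q : ℝ) (g : ℕ → X)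
    {m m' : ℕ} (h : m ≤ m') : quasiGeodesicCone x₀ q Q g m' ⊆ quasiGeodesicCone x₀ q Q g m := by
  rintro x ⟨I, f, ⟨hf, hI⟩, i, hi, hmi, hx⟩
  exact ⟨I, f, ⟨hf, fun j h1 h2 => hI j h1 (h2.trans h)⟩, i, hi, h.trans hmi, hx⟩

theorem geometric_of_close {X : Type*} [MetricSpace X] {f : X → ℂ} {S : ℕ → Set X}
    (h : ∀ ε : ℝ, 0 < ε → ∃ m : ℕ, 1 ≤ m ∧ ∀ x ∈ S m, ∀ y ∈ S m, ‖f x - f y‖ ≤ ε)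
    (ε : ℝ) (hε : 0 < ε) : ∃ m : ℕ, 1 ≤ m ∧ Metric.diam (f '' S m) < ε := by
  obtain ⟨m, hm, H⟩ := h (ε / 2) (by positivity)
  refine ⟨m, hm, lt_of_le_of_lt (Metric.diam_le_of_forall_dist_le (by positivity) ?_)
    (half_lt_self hε)⟩
  rintro _ ⟨x, hx, rfl⟩ _ ⟨y, hy, rfl⟩
  rw [dist_eq_norm]
  exact H x hx y hy

theorem IsGeometricallySlowlyOscillating.close {X : Type*} [MetricSpace X] {f : X → ℂ}
    (hf : IsGeometricallySlowlyOscillating f) {k : ℝ} (hk : 1 ≤ k) {x₀ : X} {g : ℕ → X}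
    (hg : IsIntegralQuasiGeodesicRay x₀ k k g) {ε : ℝ} (hε : 0 < ε) :
    ∃ m : ℕ, ∀ m' ≥ m, ∀ x ∈ quasiGeodesicCone x₀ k k g m',
      ∀ y ∈ quasiGeodesicCone x₀ k k g m', ‖f x - f y‖ < ε := by
  obtain ⟨m, -, hm⟩ := hf.geometric ε hε k x₀ g hk hg
  obtain ⟨C, hC⟩ := hf.bounded
  have hb : Bornology.IsBounded (f '' quasiGeodesicCone x₀ k k g m) := by
    refine (Metric.isBounded_closedBall (x := (0 : ℂ)) (r := C)).subset ?_
    rintro _ ⟨x, -, rfl⟩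
    simpa using hC x
  refine ⟨m, fun m' hm' x hx y hy => lt_of_le_of_lt ?_ hm⟩
  rw [← dist_eq_norm]
  exact Metric.dist_le_diam_of_mem hb
    ⟨x, quasiGeodesicCone_anti x₀ k k g hm' hx, rfl⟩
    ⟨y, quasiGeodesicCone_anti x₀ k k g hm' hy, rfl⟩

theorem IsGeometricallySlowlyOscillating.const {X : Type*} [MetricSpace X] (c : ℂ) :
    IsGeometricallySlowlyOscillating (fun _ : X => c) where
  continuous := continuous_const
  bounded := ⟨‖c‖, fun _ => le_rfl⟩
  slowlyOscillating := fun x y _ _ => by simp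
  geometric := fun ε hε k x₀ g _ _ =>
    geometric_of_close (fun ε hε => ⟨1, le_rfl, fun x _ y _ => by simpa using hε.le⟩) ε hε

/-- If the oscillation of `u` is controlled linearly by those of `f` and `g`, then `u` inherits
the oscillation properties. -/
theorem IsGeometricallySlowlyOscillating.of_le {X : Type*} [MetricSpace X] {f g u : X → ℂ}
    (hf : IsGeometricallySlowlyOscillating f) (hg : IsGeometricallySlowlyOscillating g)
    (hu : Continuous u) (hb : ∃ C : ℝ, ∀ x, ‖u x‖ ≤ C) {K : ℝ} (hK : 0 < K)
    (h : ∀ x y, ‖u x - u y‖ ≤ K * (‖f x - f y‖ + ‖g x - g y‖)) :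
    IsGeometricallySlowlyOscillating u where
  continuous := hu
  bounded := hb
  slowlyOscillating := fun x y hx hxy => by
    have h1 := ((hf.slowlyOscillating x y hx hxy).add
      (hg.slowlyOscillating x y hx hxy)).const_mul K
    simp only [add_zero, mul_zero] at h1
    exact squeeze_zero (fun _ => norm_nonneg _) (fun n => h (x n) (y n)) h1
  geometric := fun ε hε k x₀ r hk hr => by
    refine geometric_of_close (fun ε hε => ?_) ε hε
    have hε' : 0 < ε / (2 * K) := by positivity
    obtain ⟨m₁, h₁⟩ := hf.close hk hr hε'
    obtain ⟨m₂, h₂⟩ := hg.close hk hr hε'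
    refine ⟨max 1 (max m₁ m₂), le_max_left _ _, fun x hx y hy => (h x y).trans ?_⟩
    have a₁ := h₁ _ ((le_max_left m₁ m₂).trans (le_max_right 1 _)) x hx y hy
    have a₂ := h₂ _ ((le_max_right m₁ m₂).trans (le_max_right 1 _)) x hx y hy
    calc K * (‖f x - f y‖ + ‖g x - g y‖) ≤ K * (ε / (2 * K) + ε / (2 * K)) := by gcongr
      _ = ε := by field_simp; ring

/-- The algebra `C_QG(X)` of geometrically slowly oscillating functions, with the sup norm. -/
def quasiGeodesicAlgebra (X : Type*) [MetricSpace X] : StarSubalgebra ℂ (X →ᵇ ℂ) where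
  carrier := {f | IsGeometricallySlowlyOscillating (f : X → ℂ)}
  mul_mem' := fun {f g} hf hg => by
    refine IsGeometricallySlowlyOscillating.of_le hf hg (f * g).continuous
      ⟨‖f * g‖, (f * g).norm_coe_le_norm⟩ (K := ‖f‖ + ‖g‖ + 1) (by positivity) fun x y => ?_
    have e : (f * g) x - (f * g) y = (f x - f y) * g x + f y * (g x - g y) := by
      simp only [BoundedContinuousFunction.coe_mul, Pi.mul_apply]; ring
    have b₁ := g.norm_coe_le_norm x
    have b₂ := f.norm_coe_le_norm y
    have n₁ := norm_nonneg (f x - f y)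
    have n₂ := norm_nonneg (g x - g y)
    have n₃ := norm_nonneg f
    have n₄ := norm_nonneg g
    rw [e]
    refine (norm_add_le _ _).trans ?_
    rw [norm_mul, norm_mul]
    nlinarith [mul_le_mul_of_nonneg_left b₁ n₁, mul_le_mul_of_nonneg_right b₂ n₂,
      mul_nonneg n₁ n₃, mul_nonneg n₂ n₄]
  add_mem' := fun {f g} hf hg => by
    refine IsGeometricallySlowlyOscillating.of_le hf hg (f + g).continuous
      ⟨‖f + g‖, (f + g).norm_coe_le_norm⟩ one_pos fun x y => ?_
    have e : (f + g) x - (f + g) y = (f x - f y) + (g x - g y) := by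
      simp only [BoundedContinuousFunction.coe_add, Pi.add_apply]; ring
    rw [e, one_mul]
    exact norm_add_le _ _
  algebraMap_mem' := fun c => IsGeometricallySlowlyOscillating.const c
  star_mem' := fun {f} hf => by
    refine IsGeometricallySlowlyOscillating.of_le hf hf (star f).continuous
      ⟨‖star f‖, (star f).norm_coe_le_norm⟩ one_pos fun x y => ?_
    have e : (star f) x - (star f) y = star (f x - f y) := by simp
    rw [e, norm_star]
    linarith [norm_nonneg (f x - f y)]

/-- The quasi-geodesic compactification `X_QG`: the maximal ideal space of `C_QG(X)`, i.e. its
space of characters with the weak-* topology. -/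
abbrev QuasiGeodesicCompactification (X : Type*) [MetricSpace X] : Type _ :=
  WeakDual.characterSpace ℂ (quasiGeodesicAlgebra X)

/-- The canonical map `X → X_QG`, sending `x` to the evaluation at `x`. -/
def toQuasiGeodesicCompactification {X : Type*} [MetricSpace X] (x : X) :
    QuasiGeodesicCompactification X :=
  ⟨StrongDual.toWeakDual
      ((BoundedContinuousFunction.evalCLM ℂ x).comp
        ((quasiGeodesicAlgebra X).toSubalgebra.toSubmodule.subtypeL)), by
    refine ⟨fun h => ?_, fun f g => rfl⟩
    have h1 := DFunLike.congr_fun h (1 : quasiGeodesicAlgebra X)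
    exact one_ne_zero (α := ℂ) h1⟩

theorem toQuasiGeodesicCompactification_apply {X : Type*} [MetricSpace X] (x : X)
    (f : quasiGeodesicAlgebra X) :
    toQuasiGeodesicCompactification x f = (f : X →ᵇ ℂ) x := rfl

/-- The quasi-geodesic boundary `∂_QG X = X_QG \ X`. -/
def quasiGeodesicBoundary (X : Type*) [MetricSpace X] : Set (QuasiGeodesicCompactification X) :=
  (Set.range (toQuasiGeodesicCompactification (X := X)))ᶜ

/-! ### Gromov hyperbolic spaces -/

/-- The Gromov product `⟨x, y⟩_a`. -/
def gromovProduct {X : Type*} [MetricSpace X] (a x y : X) : ℝ :=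
  (dist x a + dist y a - dist x y) / 2

class GromovHyperbolicSpace (X : Type*) [MetricSpace X] : Prop where
  exists_delta : ∃ δ : ℝ, 0 < δ ∧ ∀ x y z a : X,
    min (gromovProduct a x z) (gromovProduct a z y) - δ / 4 ≤ gromovProduct a x y

theorem gromovProduct_comm {X : Type*} [MetricSpace X] (a x y : X) :
    gromovProduct a x y = gromovProduct a y x := by
  unfold gromovProduct
  rw [dist_comm x y]
  ring

/-- `⟨u i, v j⟩_a → ∞` as `i, j → ∞`. Finiteness of the change of base point makes the
condition independent of `a`. -/
def GromovAsymptotic {X : Type*} [MetricSpace X] (u v : ℕ → X) : Prop :=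
  ∀ a : X, Tendsto (fun n : ℕ × ℕ => gromovProduct a (u n.1) (v n.2)) atTop atTop

/-- Sequences converging to infinity in the sense of Gromov. -/
def GromovSequence (X : Type*) [MetricSpace X] : Type _ :=
  {u : ℕ → X // GromovAsymptotic u u}

instance gromovSetoid (X : Type*) [MetricSpace X] [GromovHyperbolicSpace X] :
    Setoid (GromovSequence X) where
  r u v := GromovAsymptotic u.1 v.1
  iseqv :=
    { refl := fun u => u.2
      symm := fun {u v} h a => by
        refine tendsto_atTop.2 fun R => ?_
        obtain ⟨N, hN⟩ := eventually_atTop.1 (tendsto_atTop.1 (h a) R)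
        refine eventually_atTop.2 ⟨(N.2, N.1), fun n hn => ?_⟩
        rw [gromovProduct_comm]
        exact hN (n.2, n.1) ⟨hn.2, hn.1⟩
      trans := fun {u v w} h₁ h₂ a => by
        obtain ⟨δ, -, hδ⟩ := GromovHyperbolicSpace.exists_delta (X := X)
        refine tendsto_atTop.2 fun R => ?_
        obtain ⟨N₁, hN₁⟩ := eventually_atTop.1 (tendsto_atTop.1 (h₁ a) (R + δ / 4))
        obtain ⟨N₂, hN₂⟩ := eventually_atTop.1 (tendsto_atTop.1 (h₂ a) (R + δ / 4))
        refine eventually_atTop.2 ⟨(N₁.1, N₂.2), fun n hn => ?_⟩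
        have b₁ := hN₁ (n.1, max N₁.2 N₂.1) ⟨hn.1, le_max_left _ _⟩
        have b₂ := hN₂ (max N₁.2 N₂.1, n.2) ⟨le_max_right _ _, hn.2⟩
        have b₃ := hδ (u.1 n.1) (w.1 n.2) (v.1 (max N₁.2 N₂.1)) a
        have b₄ := le_min b₁ b₂
        dsimp only at b₄ ⊢
        linarith }

/-- The Gromov boundary, as a set. -/
def GromovBoundary (X : Type*) [MetricSpace X] [GromovHyperbolicSpace X] : Type _ :=
  Quotient (gromovSetoid X)

/-- The Gromov compactification `X ∪ ∂X`, as a set. -/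
inductive GromovCompactification (X : Type*) [MetricSpace X] [GromovHyperbolicSpace X] : Type _
  | point (x : X) : GromovCompactification X
  | infinite (ξ : GromovBoundary X) : GromovCompactification X

/-- The sequences used to compute Gromov products with `z`: the constant sequence if `z ∈ X`, and
all sequences in the class `z` if `z` is a boundary point. -/
def GromovCompactification.Represents {X : Type*} [MetricSpace X] [GromovHyperbolicSpace X] :
    GromovCompactification X → (ℕ → X) → Prop
  | .point x, u => ∀ n, u n = x
  | .infinite ξ, u => ∃ h : GromovAsymptotic u u, Quotient.mk (gromovSetoid X) ⟨u, h⟩ = ξ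

/-- The extended Gromov product on `X ∪ ∂X`: the infimum of `liminf ⟨u i, v j⟩_a` over all
sequences `u`, `v` that represent the two points. -/
def extendedGromovProduct {X : Type*} [MetricSpace X] [GromovHyperbolicSpace X] (a : X)
    (z w : GromovCompactification X) : EReal :=
  ⨅ (u : ℕ → X) (v : ℕ → X) (_ : z.Represents u) (_ : w.Represents v),
    liminf (fun n : ℕ × ℕ => ((gromovProduct a (u n.1) (v n.2) : ℝ) : EReal)) atTop

/-- The standard topology on `X ∪ ∂X`: `X` is an open subspace with its metric topology, and the
sets `{w | ⟨ξ, w⟩_a > R}` form a basis of neighborhoods of a boundary point `ξ`. -/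
instance GromovCompactification.instTopologicalSpace {X : Type*} [MetricSpace X]
    [GromovHyperbolicSpace X] : TopologicalSpace (GromovCompactification X) where
  IsOpen U := IsOpen {x : X | GromovCompactification.point x ∈ U} ∧
    ∀ ξ : GromovBoundary X, GromovCompactification.infinite ξ ∈ U →
      ∀ a : X, ∃ R : ℝ, ∀ w : GromovCompactification X,
        (R : EReal) < extendedGromovProduct a (.infinite ξ) w → w ∈ U
  isOpen_univ := ⟨by simp, fun _ _ _ => ⟨0, fun _ _ => trivial⟩⟩
  isOpen_inter := fun U V hU hV => by
    refine ⟨hU.1.inter hV.1, fun ξ hξ a => ?_⟩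
    obtain ⟨R₁, h₁⟩ := hU.2 ξ hξ.1 a
    obtain ⟨R₂, h₂⟩ := hV.2 ξ hξ.2 a
    refine ⟨max R₁ R₂, fun w hw => ⟨h₁ w (lt_of_le_of_lt ?_ hw), h₂ w (lt_of_le_of_lt ?_ hw)⟩⟩
    · exact EReal.coe_le_coe_iff.2 (le_max_left _ _)
    · exact EReal.coe_le_coe_iff.2 (le_max_right _ _)
  isOpen_sUnion := fun S hS => by
    refine ⟨?_, fun ξ hξ a => ?_⟩
    · have e : {x : X | GromovCompactification.point x ∈ ⋃₀ S} =
          ⋃ U ∈ S, {x : X | GromovCompactification.point x ∈ U} := by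
        ext x; simp
      rw [e]
      exact isOpen_biUnion fun U hU => (hS U hU).1
    · obtain ⟨U, hU, hξU⟩ := hξ
      obtain ⟨R, hR⟩ := (hS U hU).2 ξ hξU a
      exact ⟨R, fun w hw => ⟨U, hU, hR w hw⟩⟩

/-- The Gromov boundary has the topology induced from `X ∪ ∂X`. -/
instance GromovBoundary.instTopologicalSpace {X : Type*} [MetricSpace X]
    [GromovHyperbolicSpace X] : TopologicalSpace (GromovBoundary X) :=
  TopologicalSpace.induced GromovCompactification.infinite inferInstance

end

/-! Put K = X ∪ ∂X. If K is compact Hausdorff with X dense, and if the geometrically slowly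
oscillating functions are exactly the restrictions of C(K), then restriction identifies C(K) with
C_QG(X). The characters of C(K) are the points of K, so X_QG is K.

Hyperbolicity makes the Gromov product ultrametric up to a defect δ, so a chain of 2^s steps loses
only sδ. Along a quasi-geodesic, neighbours near index 2^s have product of order 2^s, which beats
sδ. Summing over dyadic blocks shows that points of a far cone have large mutual products
(`exists_le_gromovProduct_cone`). Hence every ray has an endpoint, to which its cones shrink. The
same comparison of logarithmic loss with linear gain gives a Morse lemma
(`exists_forall_idealDist_le`). As X need not contain geodesics, points of a geodesic are replaced
by the distance function they would have. Consequently, asymptotic rays come within a fixed distance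
of each other arbitrarily far out.

Properness enters through `exists_ray_of_ultrafilter`: joining the base point to points tending to
infinity and passing to the limit gives a ray whose cones capture the ultrafilter. This yields
compactness of K. It also yields the extension of slowly oscillating functions: the limit along an
ultrafilter is the limit along its ray, and asymptotic rays have the same limit. Conversely, for a
continuous function on K, bounded displacements disappear at the boundary and cones shrink to
endpoints. -/

/-! ### Dyadic chains and integral intervals. -/

theorem exists_forall_linear_le_two_pow (A B : ℝ) :
    ∃ s₀ : ℕ, ∀ s : ℕ, s₀ ≤ s → A * s + B ≤ 2 ^ s := by
  have h1 : Tendsto (fun n : ℕ => (n : ℝ) / 2 ^ n) atTop (𝓝 0) := by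
    simpa using tendsto_pow_const_div_const_pow_of_one_lt 1 (one_lt_two : (1 : ℝ) < 2)
  have h2 : Tendsto (fun n : ℕ => ((1 / 2 : ℝ)) ^ n) atTop (𝓝 0) :=
    tendsto_pow_atTop_nhds_zero_of_lt_one (by norm_num) (by norm_num)
  have h3 := (h1.const_mul A).add (h2.const_mul B)
  simp only [mul_zero, add_zero] at h3
  obtain ⟨s₀, hs⟩ := eventually_atTop.1 (h3.eventually_lt_const one_pos)
  refine ⟨s₀, fun s h => ?_⟩
  have h4 := hs s h
  have e : A * ((s : ℝ) / 2 ^ s) + B * (1 / 2) ^ s = (A * s + B) / 2 ^ s := by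
    rw [one_div, inv_pow]; field_simp
  rw [e, div_lt_one (by positivity)] at h4
  exact h4.le

/-- Along a chain of at most `2 ^ s` steps, an ultrametric-type inequality with defect `δ` loses
at most `s * δ`. -/
theorem sub_mul_le_of_chain {P : ℕ → ℕ → ℝ} {δ R : ℝ} {a b : ℕ}
    (hP : ∀ i j l, min (P i j) (P j l) - δ ≤ P i l)
    (h0 : ∀ i, a ≤ i → i ≤ b → R ≤ P i i)
    (h1 : ∀ i, a ≤ i → i + 1 ≤ b → R ≤ P i (i + 1)) (s : ℕ) :
    ∀ i j, a ≤ i → i ≤ j → j ≤ b → j - i ≤ 2 ^ s → R - s * δ ≤ P i j := by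
  induction s with
  | zero =>
    intro i j hi hij hj hs
    simp only [Nat.cast_zero, zero_mul, sub_zero]
    rcases hij.eq_or_lt with rfl | hlt
    · exact h0 i hi hj
    · obtain rfl : j = i + 1 := by simp at hs; omega
      exact h1 i hi hj
  | succ s ih =>
    intro i j hi hij hj hs
    rw [pow_succ] at hs
    -- Bisect the chain: one application of the inequality costs one δ per halving. A half may
    -- degenerate to a single point, which is why `h0` is needed besides `h1`.
    have b1 := ih i ((i + j) / 2) hi (by omega) (by omega) (by omega)
    have b2 := ih ((i + j) / 2) j (by omega) (by omega) hj (by omega)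
    have b3 := hP i ((i + j) / 2) j
    have b4 := le_min b1 b2
    push_cast
    linarith

theorem IsIntegralInterval.mem_of_mem_of_le {I : Set ℕ} (hI : IsIntegralInterval I) {a b c : ℕ}
    (ha : a ∈ I) (hb : b ∈ I) (hac : a ≤ c) (hcb : c ≤ b) : c ∈ I := by
  obtain ⟨p, q, rfl⟩ := hI
  exact ⟨lt_of_lt_of_le ha.1 hac, lt_of_le_of_lt (by exact_mod_cast hcb) hb.2⟩

theorem isIntegralInterval_Icc (n : ℕ) : IsIntegralInterval (Set.Icc 1 n) := by
  refine ⟨0, (n + 1 : ℕ), ?_⟩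
  ext i
  simp only [Set.mem_Icc, Set.mem_ofPred_eq, Nat.cast_lt]
  omega

/-! ### The four point inequality along quasi-geodesics. -/

section FourPoint

variable {X : Type*} [MetricSpace X]

/-- The four point condition with constant `δ`. -/
def FourPointHyperbolic (X : Type*) [MetricSpace X] (δ : ℝ) : Prop :=
  ∀ x y z a : X, min (gromovProduct a x z) (gromovProduct a z y) - δ ≤ gromovProduct a x y

theorem FourPointHyperbolic.dist_add_dist_le {δ : ℝ} (hX : FourPointHyperbolic X δ) (u v w a : X) :
    dist u v + dist w a ≤ dist u w + dist v a + 2 * δ ∨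
      dist u v + dist w a ≤ dist w v + dist u a + 2 * δ := by
  have h := hX u v w a
  unfold gromovProduct at h
  rcases min_choice ((dist u a + dist w a - dist u w) / 2)
    ((dist w a + dist v a - dist w v) / 2) with e | e <;> rw [e] at h
  · left; linarith
  · right; linarith

theorem gromovProduct_self (a x : X) : gromovProduct a x x = dist x a := by
  unfold gromovProduct; rw [dist_self]; ring

theorem gromovProduct_le_left (a x y : X) : gromovProduct a x y ≤ dist x a := by
  unfold gromovProduct; linarith [dist_triangle_left y a x]

theorem gromovProduct_le_right (a x y : X) : gromovProduct a x y ≤ dist y a := by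
  rw [gromovProduct_comm]; exact gromovProduct_le_left a y x

theorem sub_dist_le_gromovProduct_right (a x y z : X) :
    gromovProduct a x y - dist y z ≤ gromovProduct a x z := by
  unfold gromovProduct; linarith [dist_triangle x y z, dist_triangle y z a]

theorem sub_dist_le_gromovProduct_base (a b x y : X) :
    gromovProduct a x y - dist a b ≤ gromovProduct b x y := by
  unfold gromovProduct
  linarith [dist_triangle_right x a b, dist_triangle_right y a b]

theorem IsIntegralQuasiGeodesic.dist_succ_le {k : ℝ} {I : Set ℕ} {h : ℕ → X}
    (hh : IsIntegralQuasiGeodesic k k I h) {i : ℕ} (hi : i ∈ I) (hi' : i + 1 ∈ I) :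
    dist (h i) (h (i + 1)) ≤ 2 * k := by
  have := (hh.2 i hi (i + 1) hi').2
  have e : |(i : ℝ) - ((i + 1 : ℕ) : ℝ)| = 1 := by push_cast; simp
  rw [e] at this
  linarith

/-- Logarithmic loss against linear growth: inside the block of indices from 2^s to 2^(s+1), the
distance to the base point is at least about 2^s / k, while chaining costs only sδ. The bound must
be uniform over the fan, since different members of a cone are later compared through the common
point at index `M`. -/
theorem exists_le_gromovProduct_of_inFan {δ : ℝ} (hX : FourPointHyperbolic X δ) (hδ : 0 ≤ δ)
    {k : ℝ} (hk : 1 ≤ k) (R : ℝ) :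
    ∃ M : ℕ, 1 ≤ M ∧ ∀ (x₀ : X) (I : Set ℕ) (h : ℕ → X), InFan x₀ k k I h →
      ∀ i ∈ I, M ≤ i → R ≤ gromovProduct x₀ (h M) (h i) := by
  have hk0 : 0 < k := by linarith
  -- This says (2^s - 1) / k ≥ R + 3k + (2s + 1)δ. The 3k covers the additive constant k and a step
  -- of length at most 2k; of the δ's, s pay for the chain and s + 1 are kept in reserve.
  obtain ⟨s₀, hs₀⟩ := exists_forall_linear_le_two_pow (2 * δ * k) (k * (R + δ + 3 * k) + 1)
  refine ⟨2 ^ s₀, Nat.one_le_two_pow, fun x₀ I h hh => ?_⟩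
  set P : ℕ → ℕ → ℝ := fun i j => gromovProduct x₀ (h i) (h j)
  have hP : ∀ i j l, min (P i j) (P j l) - δ ≤ P i l := fun i j l => hX _ _ _ _
  have low : ∀ i ∈ I, ((i : ℝ) - 1) / k - k ≤ dist (h i) x₀ := by
    intro i hi
    have := (hh.1.2 i hi 1 hh.2.1).1
    rw [hh.2.2] at this
    have e : ((i : ℝ) - 1) / k ≤ |(i : ℝ) - (1 : ℕ)| / k := by
      gcongr; simpa using le_abs_self ((i : ℝ) - 1)
    linarith
  have block : ∀ s, s₀ ≤ s → ∀ i ∈ I, 2 ^ s ≤ i → i ≤ 2 ^ (s + 1) →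
      R + (s + 1) * δ ≤ P (2 ^ s) i := by
    intro s hs i hi h1 h2
    have hmem : ∀ j, 2 ^ s ≤ j → j ≤ i → j ∈ I := fun j hj hj' =>
      hh.1.1.mem_of_mem_of_le hh.2.1 hi (Nat.one_le_two_pow.trans hj) hj'
    have lowj : ∀ j, 2 ^ s ≤ j → j ≤ i → ((2 : ℝ) ^ s - 1) / k - k ≤ dist (h j) x₀ := by
      intro j hj hj'
      refine le_trans ?_ (low j (hmem j hj hj'))
      gcongr
      exact_mod_cast hj
    have c := sub_mul_le_of_chain (P := P) (δ := δ) (R := ((2 : ℝ) ^ s - 1) / k - 3 * k)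
      (a := 2 ^ s) (b := i) hP
      (fun j hj hj' => by
        simp only [P, gromovProduct_self]; linarith [lowj j hj hj'])
      (fun j hj hj' => by
        have := sub_dist_le_gromovProduct_right x₀ (h j) (h j) (h (j + 1))
        rw [gromovProduct_self] at this
        have d := hh.1.dist_succ_le (hmem j hj (by omega)) (hmem (j + 1) (by omega) hj')
        simp only [P]
        linarith [lowj j hj (by omega)])
      s (2 ^ s) i le_rfl h1 le_rfl (by rw [pow_succ] at h2; omega)
    have b := hs₀ s hs
    have b' : (s : ℝ) * δ + (R + (s + 1) * δ) + 3 * k ≤ ((2 : ℝ) ^ s - 1) / k := by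
      rw [le_div_iff₀ hk0]; linarith
    linarith
  -- Joining consecutive blocks costs δ each time. The reserve sδ grows with the block, so
  -- descending from block s + 1 to block s pays this cost exactly and the final bound does not
  -- depend on the number of blocks.
  have main : ∀ r s, s₀ ≤ s → ∀ i ∈ I, 2 ^ s ≤ i → i ≤ 2 ^ (s + r) →
      R + s * δ ≤ P (2 ^ s) i := by
    intro r
    induction r with
    | zero =>
      intro s hs i hi h1 h2
      have := block s hs i hi h1 (h2.trans (Nat.pow_le_pow_right (by norm_num) (by omega)))
      linarith
    | succ r ih =>
      intro s hs i hi h1 h2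
      rcases le_total i (2 ^ (s + 1)) with h3 | h3
      · have := block s hs i hi h1 h3
        linarith
      · have b1 := ih (s + 1) (by omega) i hi h3 (by rwa [add_right_comm, add_assoc])
        have hm : 2 ^ (s + 1) ∈ I :=
          hh.1.1.mem_of_mem_of_le hh.2.1 hi Nat.one_le_two_pow h3
        have b2 := block s hs _ hm (Nat.pow_le_pow_right (by norm_num) (by omega)) le_rfl
        push_cast at b1
        have b3 := hP (2 ^ s) (2 ^ (s + 1)) i
        have b4 := le_min b2 b1
        linarith
  intro i hi hMi
  have b := main i s₀ le_rfl i hi hMi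
    (Nat.lt_two_pow_self.le.trans (Nat.pow_le_pow_right (by norm_num) (by omega)))
  have : 0 ≤ (s₀ : ℝ) * δ := by positivity
  simp only [P] at b
  linarith

/-! ### Ideal geodesics and stability of quasi-geodesics. -/

/-- The distance from `w` to the point at distance `t` from `x` on an ideal geodesic
from `x` to `y`. -/
def idealDist (x y : X) (t : ℝ) (w : X) : ℝ :=
  max (dist x w - t) (dist y w - (dist x y - t))

theorem sub_le_idealDist_left (x y : X) (t : ℝ) (w : X) : dist x w - t ≤ idealDist x y t w :=
  le_max_left _ _

theorem sub_le_idealDist_right (x y : X) (t : ℝ) (w : X) :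
    dist y w - (dist x y - t) ≤ idealDist x y t w :=
  le_max_right _ _

theorem idealDist_left (x y : X) {t : ℝ} (ht : 0 ≤ t) : idealDist x y t x = t := by
  unfold idealDist
  rw [dist_self, dist_comm y x, max_eq_right] <;> linarith

theorem idealDist_right (x y : X) {t : ℝ} (ht : t ≤ dist x y) :
    idealDist x y t y = dist x y - t := by
  unfold idealDist
  rw [dist_self, max_eq_left]
  linarith

/-- An ideal point can serve as base point with the same defect. Take as actual base point the end,
`x` or `y`, that attains the maximum at `w`: the four point inequality then has the exact value for
`w` on the small side, and for `u` and `v` the maximum can only help. -/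
theorem FourPointHyperbolic.min_idealDist_sub_le {δ : ℝ} (hX : FourPointHyperbolic X δ) (x y : X)
    (t : ℝ) (u v w : X) :
    min ((idealDist x y t u + idealDist x y t w - dist u w) / 2)
      ((idealDist x y t w + idealDist x y t v - dist w v) / 2) - δ ≤
        (idealDist x y t u + idealDist x y t v - dist u v) / 2 := by
  have h1 := min_le_left ((idealDist x y t u + idealDist x y t w - dist u w) / 2)
    ((idealDist x y t w + idealDist x y t v - dist w v) / 2)
  have h2 := min_le_right ((idealDist x y t u + idealDist x y t w - dist u w) / 2)
    ((idealDist x y t w + idealDist x y t v - dist w v) / 2)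
  have key : ∀ (a : X) (c : ℝ), (∀ p, dist p a - c ≤ idealDist x y t p) →
      dist w a - c = idealDist x y t w →
      min ((idealDist x y t u + idealDist x y t w - dist u w) / 2)
        ((idealDist x y t w + idealDist x y t v - dist w v) / 2) - δ ≤
        (idealDist x y t u + idealDist x y t v - dist u v) / 2 := by
    intro a c hc hw
    have hu := hc u
    have hv := hc v
    rcases hX.dist_add_dist_le u v w a with h | h <;> linarith
  rcases max_choice (dist x w - t) (dist y w - (dist x y - t)) with e | e
  · exact key x t (fun p => by rw [dist_comm]; exact le_max_left _ _)
      (by rw [dist_comm]; exact e.symm)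
  · exact key y (dist x y - t) (fun p => by rw [dist_comm]; exact le_max_right _ _)
      (by rw [dist_comm]; exact e.symm)

/-- Halving step for the distance from ideal geodesics to quasi-geodesics. -/
theorem exists_idealDist_le_of_two_mul {δ : ℝ} (hX : FourPointHyperbolic X δ) (hδ : 0 ≤ δ)
    {k : ℝ} (hk : 1 ≤ k) {R : ℝ} (hR : 0 ≤ R) {s : ℕ}
    (hs : k * (12 * R + 2 * δ + k) ≤ 2 ^ s) (hsR : k + (s + 2) * δ < R)
    {n : ℕ} (hn : 1 ≤ n) {h : ℕ → X} (hh : IsIntegralQuasiGeodesic k k (Set.Icc 1 n) h)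
    (H : ∀ t, 0 ≤ t → t ≤ dist (h 1) (h n) →
      ∃ i ∈ Set.Icc 1 n, idealDist (h 1) (h n) t (h i) ≤ 2 * R)
    (t : ℝ) (ht : 0 ≤ t) (htT : t ≤ dist (h 1) (h n)) :
    ∃ i ∈ Set.Icc 1 n, idealDist (h 1) (h n) t (h i) ≤ R := by
  -- Suppose the whole quasi-geodesic stays farther than R from the ideal point. Then Gromov
  -- products based there are large between neighbours, hence between the two ends by a short chain.
  -- But the ideal point lies between the ends, so their product is zero.
  by_contra! hfar
  have hk0 : 0 < k := by linarith
  have m1 : 1 ∈ Set.Icc 1 n := ⟨le_rfl, hn⟩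
  have mn : n ∈ Set.Icc 1 n := ⟨hn, le_rfl⟩
  have exy := dist_comm (h 1) (h n)
  have eDx := idealDist_left (h 1) (h n) ht
  have eDy := idealDist_right (h 1) (h n) htT
  set T := dist (h 1) (h n)
  set D := idealDist (h 1) (h n) t
  set P : ℕ → ℕ → ℝ := fun i j => (D (h i) + D (h j) - dist (h i) (h j)) / 2 with hPdef
  have hP : ∀ i j l, min (P i j) (P j l) - δ ≤ P i l := fun i j l =>
    hX.min_idealDist_sub_le _ _ _ _ _ _
  -- Shortcut: the part of the quasi-geodesic from the end to `i₁` may be arbitrarily long, but the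
  -- product across it is at least R directly. Moving back by 4R exceeds the error 2R from `H`; if
  -- there is no room, the end itself is used.
  obtain ⟨i₁, hi₁, t₁, ht₁, ht₁', hd₁, hP₁⟩ : ∃ i₁ ∈ Set.Icc 1 n, ∃ t₁, t - 4 * R ≤ t₁ ∧ t₁ ≤ t ∧
      idealDist (h 1) (h n) t₁ (h i₁) ≤ 2 * R ∧ R ≤ P 1 i₁ := by
    rcases le_total t (4 * R) with hc | hc
    · refine ⟨1, m1, 0, by linarith, ht, ?_, ?_⟩
      · rw [idealDist_left _ _ le_rfl]; linarith
      · have := hfar 1 m1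
        simp only [hPdef, dist_self]
        linarith
    · obtain ⟨i, hi, hd⟩ := H (t - 4 * R) (by linarith) (by linarith)
      refine ⟨i, hi, t - 4 * R, le_rfl, by linarith, hd, ?_⟩
      have b1 := sub_le_idealDist_left (h 1) (h n) (t - 4 * R) (h i)
      have b2 : dist (h n) (h i) - (T - t) ≤ D (h i) := sub_le_idealDist_right _ _ _ _
      have b3 : T ≤ dist (h 1) (h i) + dist (h n) (h i) := dist_triangle_right _ _ _
      simp only [hPdef]
      linarith
  obtain ⟨i₂, hi₂, t₂, ht₂, ht₂', hd₂, hP₂⟩ : ∃ i₂ ∈ Set.Icc 1 n, ∃ t₂, t₂ ≤ t + 4 * R ∧ t ≤ t₂ ∧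
      idealDist (h 1) (h n) t₂ (h i₂) ≤ 2 * R ∧ R ≤ P i₂ n := by
    rcases le_total (T - t) (4 * R) with hc | hc
    · refine ⟨n, mn, T, by linarith, htT, ?_, ?_⟩
      · rw [idealDist_right _ _ le_rfl, sub_self]; linarith
      · have := hfar n mn
        simp only [hPdef, dist_self]
        linarith
    · obtain ⟨i, hi, hd⟩ := H (t + 4 * R) (by linarith) (by linarith)
      refine ⟨i, hi, t + 4 * R, le_rfl, by linarith, hd, ?_⟩
      have b1 : dist (h n) (h i) - (T - (t + 4 * R)) ≤ _ :=
        sub_le_idealDist_right (h 1) (h n) (t + 4 * R) (h i)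
      have b2 : dist (h 1) (h i) - t ≤ D (h i) := sub_le_idealDist_left _ _ _ _
      have b3 : T ≤ dist (h 1) (h i) + dist (h n) (h i) := dist_triangle_right _ _ _
      simp only [hPdef]
      rw [dist_comm (h i)]
      linarith
  -- The parameters differ by at most 8R, each point contributes an error 2R, and the four point
  -- inequality contributes 2δ. So only boundedly many indices, in terms of R, remain to be chained.
  have hd : dist (h i₁) (h i₂) ≤ 12 * R + 2 * δ := by
    have a1 := sub_le_idealDist_left (h 1) (h n) t₁ (h i₁)
    have a2 := sub_le_idealDist_left (h 1) (h n) t₂ (h i₂)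
    have a3 : dist (h n) (h i₁) - (T - t₁) ≤ _ := sub_le_idealDist_right (h 1) (h n) t₁ (h i₁)
    have a4 : dist (h n) (h i₂) - (T - t₂) ≤ _ := sub_le_idealDist_right (h 1) (h n) t₂ (h i₂)
    rcases hX.dist_add_dist_le (h i₁) (h i₂) (h 1) (h n) with a | a
    · rw [dist_comm (h i₁) (h 1), dist_comm (h i₂) (h n)] at a
      linarith
    · rw [dist_comm (h i₁) (h n)] at a
      linarith
  have hN : |(i₁ : ℝ) - i₂| ≤ 2 ^ s := by
    have a1 := (hh.2 i₁ hi₁ i₂ hi₂).1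
    have a2 : |(i₁ : ℝ) - i₂| / k ≤ 12 * R + 2 * δ + k := by linarith
    rw [div_le_iff₀ hk0] at a2
    linarith
  have hsym : ∀ i j, P i j = P j i := fun i j => by
    simp only [hPdef]; rw [dist_comm]; ring
  have chain : ∀ i ∈ Set.Icc 1 n, ∀ j ∈ Set.Icc 1 n, i ≤ j → |(i : ℝ) - j| ≤ 2 ^ s →
      R - k - s * δ ≤ P i j := by
    intro i hi j hj hij hN
    refine sub_mul_le_of_chain (a := 1) (b := n) hP ?_ ?_ s i j hi.1 hij hj.2 ?_
    · intro l hl hl'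
      have := hfar l ⟨hl, hl'⟩
      simp only [hPdef, dist_self]
      linarith
    · intro l hl hl'
      have b1 := hfar l ⟨hl, by omega⟩
      have b2 := hfar (l + 1) ⟨by omega, hl'⟩
      have b3 := hh.dist_succ_le (i := l) ⟨hl, by omega⟩ ⟨by omega, hl'⟩
      simp only [hPdef]
      linarith
    · rw [abs_sub_comm, abs_of_nonneg (by simpa using hij), ← Nat.cast_sub hij] at hN
      exact_mod_cast hN
  have hP₁₂ : R - k - s * δ ≤ P i₁ i₂ := by
    rcases le_total i₁ i₂ with hc | hc
    · exact chain i₁ hi₁ i₂ hi₂ hc hN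
    · rw [hsym]
      exact chain i₂ hi₂ i₁ hi₁ hc (by rwa [abs_sub_comm])
  have hsδ : 0 ≤ (s : ℝ) * δ := by positivity
  have c1 := hP 1 i₁ i₂
  have c2 := le_min (show R - k - s * δ ≤ P 1 i₁ by linarith) hP₁₂
  have c3 := hP 1 i₂ n
  have c4 := le_min (show R - k - s * δ - δ ≤ P 1 i₂ by linarith)
    (show R - k - s * δ - δ ≤ P i₂ n by linarith)
  have c5 : P 1 n = 0 := by
    simp only [hPdef]
    rw [eDx, eDy]
    ring
  linarith

/-- Ideal geodesics stay close to quasi-geodesics with the same end points. -/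
theorem exists_forall_idealDist_le {δ : ℝ} (hX : FourPointHyperbolic X δ) (hδ : 0 ≤ δ)
    {k : ℝ} (hk : 1 ≤ k) :
    ∃ R : ℝ, ∀ (n : ℕ) (h : ℕ → X), 1 ≤ n → IsIntegralQuasiGeodesic k k (Set.Icc 1 n) h →
      ∀ t, 0 ≤ t → t ≤ dist (h 1) (h n) →
        ∃ i ∈ Set.Icc 1 n, idealDist (h 1) (h n) t (h i) ≤ R := by
  -- For R = 2^r the chain length fits in 2^(r + c), so the loss is linear in r while R is
  -- exponential. Halving therefore works down to a threshold `r₀` independent of the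
  -- quasi-geodesic; it starts from the trivial bound by the distance between the ends.
  obtain ⟨c, hc⟩ := pow_unbounded_of_one_lt (k * (12 + 2 * δ + k)) (one_lt_two : (1 : ℝ) < 2)
  obtain ⟨r₀, hr₀⟩ := exists_forall_linear_le_two_pow δ (k + (c + 2) * δ + 1)
  refine ⟨2 ^ r₀, fun n h hn hh => ?_⟩
  have step : ∀ m : ℕ, (∀ t, 0 ≤ t → t ≤ dist (h 1) (h n) →
      ∃ i ∈ Set.Icc 1 n, idealDist (h 1) (h n) t (h i) ≤ 2 ^ (r₀ + m)) →
      ∀ t, 0 ≤ t → t ≤ dist (h 1) (h n) →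
        ∃ i ∈ Set.Icc 1 n, idealDist (h 1) (h n) t (h i) ≤ 2 ^ r₀ := by
    intro m
    induction m with
    | zero => exact id
    | succ m ih =>
      intro H
      refine ih (exists_idealDist_le_of_two_mul hX hδ hk (by positivity) (s := r₀ + m + c)
        ?_ ?_ hn hh ?_)
      · have h1 : (1 : ℝ) ≤ 2 ^ (r₀ + m) := one_le_pow₀ one_le_two
        have h2 : (0 : ℝ) ≤ 2 * δ + k := by linarith
        have h3 : 12 * (2 : ℝ) ^ (r₀ + m) + 2 * δ + k ≤ 2 ^ (r₀ + m) * (12 + 2 * δ + k) := by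
          nlinarith
        calc k * (12 * (2 : ℝ) ^ (r₀ + m) + 2 * δ + k)
            ≤ k * (2 ^ (r₀ + m) * (12 + 2 * δ + k)) := by gcongr
          _ = 2 ^ (r₀ + m) * (k * (12 + 2 * δ + k)) := by ring
          _ ≤ 2 ^ (r₀ + m) * 2 ^ c := by gcongr
          _ = 2 ^ (r₀ + m + c) := (pow_add _ _ _).symm
      · have := hr₀ (r₀ + m) (by omega)
        push_cast at this ⊢
        linarith
      · intro t ht htT
        obtain ⟨i, hi, hd⟩ := H t ht htT
        refine ⟨i, hi, hd.trans (le_of_eq ?_)⟩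
        rw [← add_assoc, pow_succ]; ring
  obtain ⟨m, hm⟩ := pow_unbounded_of_one_lt (dist (h 1) (h n)) (one_lt_two : (1 : ℝ) < 2)
  refine step m fun t ht htT => ⟨1, ⟨le_rfl, hn⟩, ?_⟩
  rw [idealDist_left _ _ ht]
  exact htT.trans (hm.le.trans (pow_le_pow_right₀ one_le_two (by omega)))

/-- Asymptotic quasi-geodesic rays come uniformly close to each other arbitrarily far out. -/
theorem exists_dist_le_of_asymptotic_rays {δ : ℝ} (hX : FourPointHyperbolic X δ) (hδ : 0 ≤ δ)
    {k : ℝ} (hk : 1 ≤ k) :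
    ∃ C : ℝ, ∀ (x₀ : X) (g g' : ℕ → X), IsIntegralQuasiGeodesicRay x₀ k k g →
      IsIntegralQuasiGeodesicRay x₀ k k g' →
      (∀ R : ℝ, ∃ n n' : ℕ, 1 ≤ n ∧ 1 ≤ n' ∧ R ≤ gromovProduct x₀ (g n) (g' n')) →
      ∀ t : ℝ, 0 ≤ t → ∃ i j : ℕ, dist (g i) (g' j) ≤ C ∧ t ≤ dist (g i) x₀ := by
  obtain ⟨R, hR⟩ := exists_forall_idealDist_le hX hδ hk
  refine ⟨4 * |R| + 4 * δ, fun x₀ g g' hg hg' hgg' t₀ ht₀ => ?_⟩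
  have hRle := le_abs_self R
  have hRnn := abs_nonneg R
  -- The segments to `g n` and `g' n'` fellow-travel up to the product of these points, so near
  -- parameter t both rays have a point within |R| of almost the same place. The surplus |R|
  -- guarantees distance `t₀` from the base point.
  set t := t₀ + |R|
  have ht : 0 ≤ t := by positivity
  obtain ⟨n, n', hn, hn', hp⟩ := hgg' t
  have restrict : ∀ (f : ℕ → X) (m : ℕ), IsIntegralQuasiGeodesicRay x₀ k k f →
      IsIntegralQuasiGeodesic k k (Set.Icc 1 m) f := fun f m hf =>
    ⟨isIntegralInterval_Icc m, fun i hi j hj => hf.1.2 i hi.1 j hj.1⟩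
  have T1 := gromovProduct_le_left x₀ (g n) (g' n')
  have T2 := gromovProduct_le_right x₀ (g n) (g' n')
  have e1 := hg.2.2
  have e2 := hg'.2.2
  obtain ⟨i, hi, hd⟩ := hR n g hn (restrict g n hg) t ht
    (by rw [e1, dist_comm]; linarith)
  obtain ⟨j, hj, hd'⟩ := hR n' g' hn' (restrict g' n' hg') t ht
    (by rw [e2, dist_comm]; linarith)
  rw [e1] at hd
  rw [e2] at hd'
  have a1 := sub_le_idealDist_left x₀ (g n) t (g i)
  have a2 := sub_le_idealDist_right x₀ (g n) t (g i)
  have a3 := sub_le_idealDist_left x₀ (g' n') t (g' j)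
  have a4 := sub_le_idealDist_right x₀ (g' n') t (g' j)
  have b1 := dist_triangle_right x₀ (g n) (g i)
  have b2 := dist_triangle_right x₀ (g' n') (g' j)
  refine ⟨i, j, ?_, ?_⟩
  · have p1 : t - |R| ≤ gromovProduct x₀ (g i) (g n) := by
      unfold gromovProduct
      rw [dist_comm (g i) x₀, dist_comm (g n) x₀, dist_comm (g i) (g n)]
      linarith
    have p2 : t - |R| ≤ gromovProduct x₀ (g' n') (g' j) := by
      unfold gromovProduct
      rw [dist_comm (g' j) x₀, dist_comm (g' n') x₀]
      linarith
    have c1 := hX (g i) (g' n') (g n) x₀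
    have c2 := le_min p1 (show t - |R| ≤ gromovProduct x₀ (g n) (g' n') by linarith)
    have c3 := hX (g i) (g' j) (g' n') x₀
    have c4 := le_min (show t - |R| - δ ≤ gromovProduct x₀ (g i) (g' n') by linarith)
      (show t - |R| - δ ≤ gromovProduct x₀ (g' n') (g' j) by linarith)
    have c5 : t - |R| - 2 * δ ≤ gromovProduct x₀ (g i) (g' j) := by linarith
    unfold gromovProduct at c5
    rw [dist_comm (g i) x₀, dist_comm (g' j) x₀] at c5
    linarith
  · rw [dist_comm (g i) x₀]
    have : t = t₀ + |R| := rfl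
    linarith

end FourPoint

/-! ### Limit rays in proper spaces. -/

theorem IsIntegrallyQuasiGeodesic.exists_single_constant {X : Type*} [MetricSpace X]
    (hX : IsIntegrallyQuasiGeodesic X) :
    ∃ k : ℝ, 1 ≤ k ∧ ∀ x y : X, ∃ (n : ℕ) (g : ℕ → X), 1 ≤ n ∧
      IsIntegralQuasiGeodesic k k (Set.Icc 1 n) g ∧ g 1 = x ∧ g n = y := by
  obtain ⟨q, Q, hq, hQ, H⟩ := hX
  refine ⟨max q Q, le_max_of_le_left hq, fun x y => ?_⟩
  obtain ⟨n, g, hn, hg, h1, h2⟩ := H x y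
  refine ⟨n, g, hn, ⟨hg.1, fun i hi j hj => ?_⟩, h1, h2⟩
  obtain ⟨a, b⟩ := hg.2 i hi j hj
  have hq' : q ≤ max q Q := le_max_left _ _
  have hQ' : Q ≤ max q Q := le_max_right _ _
  constructor
  · refine le_trans ?_ a
    gcongr
  · refine b.trans ?_
    gcongr

/-- In a proper integrally quasi-geodesic space, every ultrafilter converging to infinity
eventually lies in the cones of some quasi-geodesic ray. -/
theorem exists_ray_of_ultrafilter {X : Type*} [MetricSpace X] [ProperSpace X]
    (hX : IsIntegrallyQuasiGeodesic X) :
    ∃ k : ℝ, 1 ≤ k ∧ ∀ (x₀ : X) (U : Ultrafilter X), (U : Filter X) ≤ Bornology.cobounded X →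
      ∃ g : ℕ → X, IsIntegralQuasiGeodesicRay x₀ k k g ∧
        ∀ m : ℕ, 1 ≤ m → ∀ᶠ x in (U : Filter X), x ∈ quasiGeodesicCone x₀ k k g m := by
  obtain ⟨κ, hκ, H⟩ := hX.exists_single_constant
  -- The spliced path below moves each point by at most 1, so distances change by at most 2.
  refine ⟨κ + 2, by linarith, fun x₀ U hU => ?_⟩
  choose n h hn hh h1 hlast using H x₀
  have large : ∀ m : ℕ, ∀ᶠ x in (U : Filter X), m < n x := by
    intro m
    have h2 := ((Metric.tendsto_dist_right_cobounded_atTop x₀).mono_left hU).eventually_gt_atTop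
      (κ * m + κ)
    filter_upwards [h2] with x hx
    by_contra! hc
    have h3 := ((hh x).2 1 ⟨le_rfl, hn x⟩ (n x) ⟨hn x, le_rfl⟩).2
    rw [h1, hlast, dist_comm] at h3
    have h4 : |((1 : ℕ) : ℝ) - n x| ≤ m := by
      have a1 : (1 : ℝ) ≤ n x := by exact_mod_cast hn x
      have a2 : (n x : ℝ) ≤ m := by exact_mod_cast hc
      rw [Nat.cast_one, abs_le]
      constructor <;> linarith
    have h5 : κ * |((1 : ℕ) : ℝ) - n x| ≤ κ * m := by gcongr
    linarith
  have lim : ∀ j : ℕ, ∃ p : X, 1 ≤ j → Tendsto (fun x => h x j) U (𝓝 p) := by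
    intro j
    by_cases hj : 1 ≤ j
    · have hb : ∀ᶠ x in (U : Filter X), h x j ∈ Metric.closedBall x₀ (κ * |(j : ℝ) - 1| + κ) := by
        filter_upwards [large j] with x hx
        have h3 := ((hh x).2 j ⟨hj, hx.le⟩ 1 ⟨le_rfl, hn x⟩).2
        rw [h1, Nat.cast_one] at h3
        exact h3
      obtain ⟨p, -, hp⟩ := (isCompact_closedBall x₀ (κ * |(j : ℝ) - 1| + κ)).ultrafilter_le_nhds
        (U.map fun x => h x j) (le_principal_iff.2 hb)
      exact ⟨p, fun _ => hp⟩
    · exact ⟨x₀, fun h => absurd h hj⟩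
  choose g hg using lim
  have hg1 : g 1 = x₀ := by
    refine tendsto_nhds_unique (hg 1 le_rfl) ?_
    simp only [h1]
    exact tendsto_const_nhds
  have weaken : ∀ r : ℝ, 0 ≤ r → r / (κ + 2) ≤ r / κ ∧ κ * r ≤ (κ + 2) * r := fun r hr =>
    ⟨by gcongr; linarith, by gcongr; linarith⟩
  have hgq : ∀ i : ℕ, 1 ≤ i → ∀ j : ℕ, 1 ≤ j → |(i : ℝ) - j| / κ - κ ≤ dist (g i) (g j) ∧
      dist (g i) (g j) ≤ κ * |(i : ℝ) - j| + κ := by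
    intro i hi j hj
    have ht := (hg i hi).dist (hg j hj)
    have hev : ∀ᶠ x in (U : Filter X), |(i : ℝ) - j| / κ - κ ≤ dist (h x i) (h x j) ∧
        dist (h x i) (h x j) ≤ κ * |(i : ℝ) - j| + κ := by
      filter_upwards [large i, large j] with x hxi hxj
      exact (hh x).2 i ⟨hi, hxi.le⟩ j ⟨hj, hxj.le⟩
    exact ⟨ge_of_tendsto ht (hev.mono fun _ h => h.1), le_of_tendsto ht (hev.mono fun _ h => h.2)⟩
  refine ⟨g, ⟨⟨⟨0, ⊤, ?_⟩, fun i hi j hj => ?_⟩, le_refl 1, hg1⟩, fun m hm => ?_⟩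
  · ext i
    simp [Nat.succ_le_iff]
  · have w := weaken |(i : ℝ) - j| (abs_nonneg _)
    have b := hgq i hi j hj
    constructor <;> linarith
  · have hclose : ∀ᶠ x in (U : Filter X), ∀ j ∈ Finset.Icc 1 m, dist (h x j) (g j) < 1 := by
      refine (eventually_all_finset _).2 fun j hj => ?_
      exact (hg j (Finset.mem_Icc.1 hj).1) (Metric.ball_mem_nhds _ one_pos)
    filter_upwards [large m, hclose] with x hx hc
    -- Follow the limit ray up to index `m`, then the quasi-geodesic towards `x`. Its last index
    -- exceeds `m`, so the path still ends at `x`.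
    refine ⟨Set.Icc 1 (n x), fun i => if i ≤ m then g i else h x i,
      ⟨⟨⟨isIntegralInterval_Icc _, fun i hi j hj => ?_⟩, ⟨le_rfl, hn x⟩, ?_⟩,
        fun i hi him => ⟨⟨hi, him.trans hx.le⟩, if_pos him⟩⟩, n x, ⟨hn x, le_rfl⟩, hx.le, ?_⟩
    · have near : ∀ i, i ∈ Set.Icc 1 (n x) → dist (if i ≤ m then g i else h x i) (h x i) ≤ 1 := by
        intro i hi
        split_ifs with hc'
        · rw [dist_comm]
          exact (hc i (Finset.mem_Icc.2 ⟨hi.1, hc'⟩)).le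
        · simp
      have a1 := near i hi
      have a2 := near j hj
      have w := weaken |(i : ℝ) - j| (abs_nonneg _)
      have b := (hh x).2 i hi j hj
      have c1 := dist_triangle4 (if i ≤ m then g i else h x i) (h x i) (h x j)
        (if j ≤ m then g j else h x j)
      have c2 := dist_triangle4 (h x i) (if i ≤ m then g i else h x i)
        (if j ≤ m then g j else h x j) (h x j)
      rw [dist_comm (h x j)] at c1
      rw [dist_comm (h x i) (if i ≤ m then g i else h x i)] at c2
      constructor <;> linarith
    · simp only [if_pos hm, hg1]
    · simp only [if_neg (not_le.2 hx), hlast]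

/-! ### The extended Gromov product. -/

section Compactification

variable {X : Type*} [MetricSpace X]

theorem GromovAsymptotic.exists_forall_le {u v : ℕ → X} (h : GromovAsymptotic u v) (a : X)
    (R : ℝ) : ∃ N, ∀ i, N ≤ i → ∀ j, N ≤ j → R ≤ gromovProduct a (u i) (v j) := by
  obtain ⟨N, hN⟩ := eventually_atTop.1 (tendsto_atTop.1 (h a) R)
  exact ⟨max N.1 N.2, fun i hi j hj =>
    hN (i, j) ⟨(le_max_left _ _).trans hi, (le_max_right _ _).trans hj⟩⟩

theorem gromovAsymptotic_of_forall {u v : ℕ → X} (a : X)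
    (h : ∀ R : ℝ, ∃ N, ∀ i, N ≤ i → ∀ j, N ≤ j → R ≤ gromovProduct a (u i) (v j)) :
    GromovAsymptotic u v := by
  intro b
  refine tendsto_atTop.2 fun R => ?_
  obtain ⟨N, hN⟩ := h (R + dist a b)
  refine eventually_atTop.2 ⟨(N, N), fun n hn => ?_⟩
  have h1 := hN n.1 hn.1 n.2 hn.2
  have h2 := sub_dist_le_gromovProduct_base a b (u n.1) (v n.2)
  linarith

theorem IsIntegralQuasiGeodesicRay.mem_cone {x₀ : X} {q Q : ℝ} {g : ℕ → X}
    (hg : IsIntegralQuasiGeodesicRay x₀ q Q g) {m i : ℕ} (hm : 1 ≤ m) (hi : m ≤ i) :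
    g i ∈ quasiGeodesicCone x₀ q Q g m :=
  ⟨{i | 1 ≤ i}, g, ⟨hg, fun _ h1 _ => ⟨h1, rfl⟩⟩, i, hm.trans hi, hi, rfl⟩

/-- All members of the thread pass through `g M`, and each has large product with it; comparing
through `g M` costs one δ. -/
theorem exists_le_gromovProduct_cone {δ : ℝ} (hX : FourPointHyperbolic X δ) (hδ : 0 ≤ δ)
    {k : ℝ} (hk : 1 ≤ k) (x₀ : X) (g : ℕ → X) (R : ℝ) :
    ∃ M : ℕ, 1 ≤ M ∧ ∀ x ∈ quasiGeodesicCone x₀ k k g M, ∀ y ∈ quasiGeodesicCone x₀ k k g M,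
      R ≤ gromovProduct x₀ x y := by
  obtain ⟨M, hM, H⟩ := exists_le_gromovProduct_of_inFan hX hδ hk (R + δ)
  have key : ∀ x ∈ quasiGeodesicCone x₀ k k g M, R + δ ≤ gromovProduct x₀ (g M) x := by
    rintro x ⟨I, h, ⟨hI, hg⟩, i, hi, hMi, rfl⟩
    rw [← (hg M hM le_rfl).2]
    exact H x₀ I h hI i hi hMi
  refine ⟨M, hM, fun x hx y hy => ?_⟩
  have b1 := key x hx
  rw [gromovProduct_comm] at b1
  have b2 := le_min b1 (key y hy)
  have b3 := hX x y (g M) x₀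
  linarith

variable [GromovHyperbolicSpace X]

theorem exists_fourPointHyperbolic (X : Type*) [MetricSpace X] [GromovHyperbolicSpace X] :
    ∃ δ : ℝ, 0 ≤ δ ∧ FourPointHyperbolic X δ := by
  obtain ⟨δ, hδ, h⟩ := GromovHyperbolicSpace.exists_delta (X := X)
  exact ⟨δ / 4, by positivity, h⟩

namespace GromovCompactification

theorem exists_represents (z : GromovCompactification X) : ∃ u, z.Represents u := by
  cases z with
  | point x => exact ⟨fun _ => x, fun _ => rfl⟩
  | infinite ξ =>
    obtain ⟨u, rfl⟩ := Quotient.exists_rep ξ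
    exact ⟨u.1, u.2, rfl⟩

theorem represents_point (x : X) : (point x : GromovCompactification X).Represents fun _ => x :=
  fun _ => rfl

theorem Represents.asymptotic {ξ : GromovBoundary X} {u v : ℕ → X}
    (hu : (infinite ξ).Represents u) (hv : (infinite ξ).Represents v) : GromovAsymptotic u v := by
  obtain ⟨h1, e1⟩ := hu
  obtain ⟨h2, e2⟩ := hv
  exact Quotient.exact (s := gromovSetoid X) (e1.trans e2.symm)

/-- Changing the representing sequence costs one δ, uniformly in the other argument. The truncation
at R is there because two representatives of a boundary point have arbitrarily large, but finite,
products. -/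
theorem Represents.exists_min_sub_le {δ : ℝ} (hX : FourPointHyperbolic X δ) (hδ : 0 ≤ δ)
    {z : GromovCompactification X} {u v : ℕ → X} (hu : z.Represents u) (hv : z.Represents v)
    (a : X) (R : ℝ) : ∃ N, ∀ i, N ≤ i → ∀ j, N ≤ j → ∀ p,
      min R (gromovProduct a (v j) p) - δ ≤ gromovProduct a (u i) p := by
  cases z with
  | point x =>
    refine ⟨0, fun i _ j _ p => ?_⟩
    rw [hu i, hv j]
    have := min_le_right R (gromovProduct a x p)
    linarith
  | infinite ξ =>
    obtain ⟨N, hN⟩ := (hu.asymptotic hv).exists_forall_le a R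
    refine ⟨N, fun i hi j hj p => le_trans ?_ (hX _ _ (v j) a)⟩
    gcongr
    exact hN i hi j hj

theorem exists_lt_of_lt_extendedGromovProduct {a : X} {z w : GromovCompactification X} {R : ℝ}
    (h : (R : EReal) < extendedGromovProduct a z w) {u v : ℕ → X} (hu : z.Represents u)
    (hv : w.Represents v) :
    ∃ N, ∀ i, N ≤ i → ∀ j, N ≤ j → R < gromovProduct a (u i) (v j) := by
  have h1 : (R : EReal) <
      liminf (fun n : ℕ × ℕ => ((gromovProduct a (u n.1) (v n.2) : ℝ) : EReal)) atTop :=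
    h.trans_le <| iInf_le_of_le u <| iInf_le_of_le v <| iInf_le_of_le hu <| iInf_le_of_le hv le_rfl
  obtain ⟨N, hN⟩ := eventually_atTop.1 (eventually_lt_of_lt_liminf h1)
  exact ⟨max N.1 N.2, fun i hi j hj => by
    exact_mod_cast hN (i, j) ⟨(le_max_left _ _).trans hi, (le_max_right _ _).trans hj⟩⟩

theorem le_extendedGromovProduct {a : X} {z w : GromovCompactification X} {R : ℝ}
    (h : ∀ u v, z.Represents u → w.Represents v →
      ∃ N, ∀ i, N ≤ i → ∀ j, N ≤ j → R ≤ gromovProduct a (u i) (v j)) :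
    (R : EReal) ≤ extendedGromovProduct a z w := by
  refine le_iInf₂ fun u v => le_iInf₂ fun hu hv => ?_
  obtain ⟨N, hN⟩ := h u v hu hv
  refine le_liminf_of_le (by isBoundedDefault) ?_
  exact eventually_atTop.2 ⟨(N, N), fun n hn => by exact_mod_cast hN n.1 hn.1 n.2 hn.2⟩

theorem lt_of_le_of_lt_coe {R S : ℝ} {e : EReal} (h : (S : EReal) ≤ e) (hRS : R < S) :
    (R : EReal) < e :=
  lt_of_lt_of_le (by exact_mod_cast hRS) h

/-- Makes the infimum computable: one pair of representatives, tested at arbitrarily late indices,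
controls all pairs, at the price of one δ for each of the two changes of sequence. -/
theorem le_extendedGromovProduct_of_represents {δ : ℝ} (hX : FourPointHyperbolic X δ)
    (hδ : 0 ≤ δ) {a : X} {z w : GromovCompactification X} {R : ℝ} {u v : ℕ → X}
    (hu : z.Represents u) (hv : w.Represents v)
    (h : ∀ N, ∃ i, N ≤ i ∧ ∃ j, N ≤ j ∧ R + 2 * δ ≤ gromovProduct a (u i) (v j)) :
    (R : EReal) ≤ extendedGromovProduct a z w := by
  refine le_extendedGromovProduct fun u' v' hu' hv' => ?_
  obtain ⟨N₁, h₁⟩ := hu'.exists_min_sub_le hX hδ hu a (R + 2 * δ)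
  obtain ⟨N₂, h₂⟩ := hv'.exists_min_sub_le hX hδ hv a (R + 2 * δ)
  obtain ⟨i₀, hi₀, j₀, hj₀, hp⟩ := h (max N₁ N₂)
  refine ⟨max N₁ N₂, fun i hi j hj => ?_⟩
  have b₁ := h₁ i ((le_max_left _ _).trans hi) i₀ ((le_max_left _ _).trans hi₀) (v' j)
  have b₂ := h₂ j ((le_max_right _ _).trans hj) j₀ ((le_max_right _ _).trans hj₀) (u i₀)
  rw [gromovProduct_comm a (v j₀), min_eq_left hp, gromovProduct_comm] at b₂
  have b₃ := le_min (show R + 2 * δ - δ ≤ R + 2 * δ by linarith) b₂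
  linarith

theorem sub_le_extendedGromovProduct_trans {δ : ℝ} (hX : FourPointHyperbolic X δ) {a : X}
    {z w v : GromovCompactification X} {R : ℝ} (h₁ : (R : EReal) < extendedGromovProduct a z w)
    (h₂ : (R : EReal) < extendedGromovProduct a w v) :
    ((R - δ : ℝ) : EReal) ≤ extendedGromovProduct a z v := by
  refine le_extendedGromovProduct fun u u' hu hu' => ?_
  obtain ⟨s, hs⟩ := w.exists_represents
  obtain ⟨N₁, b₁⟩ := exists_lt_of_lt_extendedGromovProduct h₁ hu hs
  obtain ⟨N₂, b₂⟩ := exists_lt_of_lt_extendedGromovProduct h₂ hs hu'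
  refine ⟨max N₁ N₂, fun i hi j hj => ?_⟩
  have c₁ := b₁ i ((le_max_left _ _).trans hi) (max N₁ N₂) (le_max_left _ _)
  have c₂ := b₂ (max N₁ N₂) (le_max_right _ _) j ((le_max_right _ _).trans hj)
  have c₃ := hX (u i) (u' j) (s (max N₁ N₂)) a
  have c₄ := le_min c₁.le c₂.le
  linarith

theorem le_extendedGromovProduct_symm {a : X} {z w : GromovCompactification X} {R : ℝ}
    (h : (R : EReal) < extendedGromovProduct a z w) :
    (R : EReal) ≤ extendedGromovProduct a w z := by
  refine le_extendedGromovProduct fun u v hu hv => ?_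
  obtain ⟨N, hN⟩ := exists_lt_of_lt_extendedGromovProduct h hv hu
  refine ⟨N, fun i hi j hj => ?_⟩
  rw [gromovProduct_comm]
  exact (hN j hj i hi).le

theorem sub_dist_le_extendedGromovProduct_base {a b : X} {z w : GromovCompactification X} {R : ℝ}
    (h : (R : EReal) < extendedGromovProduct a z w) :
    ((R - dist a b : ℝ) : EReal) ≤ extendedGromovProduct b z w := by
  refine le_extendedGromovProduct fun u v hu hv => ?_
  obtain ⟨N, hN⟩ := exists_lt_of_lt_extendedGromovProduct h hu hv
  refine ⟨N, fun i hi j hj => ?_⟩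
  have h1 := hN i hi j hj
  have h2 := sub_dist_le_gromovProduct_base a b (u i) (v j)
  linarith

theorem sub_dist_le_extendedGromovProduct_point {a x y : X} {z : GromovCompactification X} {R : ℝ}
    (h : (R : EReal) < extendedGromovProduct a z (point x)) :
    ((R - dist x y : ℝ) : EReal) ≤ extendedGromovProduct a z (point y) := by
  refine le_extendedGromovProduct fun u v hu hv => ?_
  obtain ⟨N, hN⟩ := exists_lt_of_lt_extendedGromovProduct h hu (represents_point x)
  refine ⟨N, fun i hi j hj => ?_⟩
  have h1 := hN i hi j hj
  have h2 := sub_dist_le_gromovProduct_right a (u i) x y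
  rw [hv j]
  linarith

theorem lt_dist_of_lt_extendedGromovProduct {a x : X} {z : GromovCompactification X} {R : ℝ}
    (h : (R : EReal) < extendedGromovProduct a z (point x)) : R < dist x a := by
  obtain ⟨u, hu⟩ := z.exists_represents
  obtain ⟨N, hN⟩ := exists_lt_of_lt_extendedGromovProduct h hu (represents_point x)
  exact (hN N le_rfl N le_rfl).trans_le (gromovProduct_le_right _ _ _)

theorem le_extendedGromovProduct_point_self {a x : X} {R : ℝ} (h : R ≤ dist x a) :
    (R : EReal) ≤ extendedGromovProduct a (point x) (point x) := by
  refine le_extendedGromovProduct fun u v hu hv => ⟨0, fun i _ j _ => ?_⟩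
  rw [hu i, hv j, gromovProduct_self]
  exact h

theorem lt_extendedGromovProduct_infinite_self (a : X) (ξ : GromovBoundary X) (R : ℝ) :
    (R : EReal) < extendedGromovProduct a (infinite ξ) (infinite ξ) := by
  refine lt_of_le_of_lt_coe (S := R + 1) (le_extendedGromovProduct fun u v hu hv => ?_)
    (by linarith)
  exact (hu.asymptotic hv).exists_forall_le a _

theorem infinite_eq_of_forall_lt {a : X} {ξ η : GromovBoundary X}
    (h : ∀ R : ℝ, (R : EReal) < extendedGromovProduct a (infinite ξ) (infinite η)) : ξ = η := by
  obtain ⟨u, hu⟩ := (infinite ξ).exists_represents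
  obtain ⟨v, hv⟩ := (infinite η).exists_represents
  obtain ⟨hu', rfl⟩ := id hu
  obtain ⟨hv', rfl⟩ := id hv
  refine Quotient.sound (s := gromovSetoid X) ?_
  refine gromovAsymptotic_of_forall a fun R => ?_
  obtain ⟨N, hN⟩ := exists_lt_of_lt_extendedGromovProduct (h R) hu hv
  exact ⟨N, fun i hi j hj => (hN i hi j hj).le⟩

theorem exists_point_lt_extendedGromovProduct (a : X) (ξ : GromovBoundary X) (R : ℝ) :
    ∃ x : X, (R : EReal) < extendedGromovProduct a (infinite ξ) (point x) := by
  obtain ⟨δ, hδ, hX⟩ := exists_fourPointHyperbolic X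
  obtain ⟨u, hu⟩ := (infinite ξ).exists_represents
  obtain ⟨N, hN⟩ := (hu.asymptotic hu).exists_forall_le a (R + 1 + 2 * δ)
  refine ⟨u N, lt_of_le_of_lt_coe (S := R + 1) ?_ (by linarith)⟩
  exact le_extendedGromovProduct_of_represents hX hδ hu (represents_point _) fun M =>
    ⟨max M N, le_max_left _ _, M, le_rfl, hN _ (le_max_right _ _) _ le_rfl⟩

/-! ### The topology -/

theorem isOpen_iff {U : Set (GromovCompactification X)} :
    IsOpen U ↔ IsOpen {x : X | point x ∈ U} ∧
      ∀ ξ : GromovBoundary X, infinite ξ ∈ U →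
        ∀ a : X, ∃ R : ℝ, ∀ w : GromovCompactification X,
          (R : EReal) < extendedGromovProduct a (.infinite ξ) w → w ∈ U :=
  Iff.rfl

theorem isOpenEmbedding_point :
    IsOpenEmbedding (point : X → GromovCompactification X) := by
  refine IsOpenEmbedding.of_continuous_injective_isOpenMap ?_ ?_ ?_
  · exact continuous_def.2 fun U hU => (isOpen_iff.1 hU).1
  · intro x y h
    exact GromovCompactification.point.inj h
  · intro U hU
    refine isOpen_iff.2 ⟨?_, ?_⟩
    · convert hU using 1
      ext x
      simp
    · rintro ξ ⟨x, -, hx⟩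
      cases hx

theorem isEmbedding_infinite :
    IsEmbedding (infinite : GromovBoundary X → GromovCompactification X) :=
  ⟨⟨rfl⟩, fun _ _ h => infinite.inj h⟩

/-- The topology is prescribed through its open sets, so this needs an argument: the set `V` of
points around which `A` contains a basic set is itself open, because the hyperbolic inequality
places a smaller basic set inside `V`. -/
theorem setOf_lt_extendedGromovProduct_mem_nhds (a : X) (ξ : GromovBoundary X) (R : ℝ) :
    {w | (R : EReal) < extendedGromovProduct a (infinite ξ) w} ∈ 𝓝 (infinite ξ) := by
  obtain ⟨δ, hδ, hX⟩ := exists_fourPointHyperbolic X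
  set A := {w | (R : EReal) < extendedGromovProduct a (infinite ξ) w} with hA
  let V : Set (GromovCompactification X) :=
    point '' interior (point ⁻¹' A) ∪
      infinite '' {η | ∃ R' : ℝ, ∀ w, (R' : EReal) < extendedGromovProduct a (infinite η) w → w ∈ A}
  refine mem_nhds_iff.2 ⟨V, ?_, ?_, ?_⟩
  · rintro w (⟨x, hx, rfl⟩ | ⟨η, ⟨R', hR'⟩, rfl⟩)
    · exact interior_subset (s := point ⁻¹' A) hx
    · exact hR' _ (lt_extendedGromovProduct_infinite_self _ _ _)
  · refine isOpen_iff.2 ⟨?_, ?_⟩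
    · convert isOpen_interior (s := (point ⁻¹' A : Set X)) using 1
      ext x
      simp [V]
    · rintro η hη b
      obtain ⟨R', hR'⟩ : ∃ R' : ℝ, ∀ w,
          (R' : EReal) < extendedGromovProduct a (infinite η) w → w ∈ A := by
        rcases hη with ⟨x, -, hx⟩ | ⟨η', h, e⟩
        · cases hx
        · cases e
          exact h
      -- `dist b a` pays for the change of base point and δ for the hyperbolic inequality; the 2
      -- leaves room for strict inequalities and for moving a point of X within a unit ball.
      refine ⟨R' + δ + 2 + dist b a, fun w hw => ?_⟩
      have hw' := sub_dist_le_extendedGromovProduct_base (b := a) hw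
      cases w with
      | point x =>
        refine Or.inl ⟨x, mem_interior_iff_mem_nhds.2 ?_, rfl⟩
        filter_upwards [Metric.ball_mem_nhds x one_pos] with y hy
        rw [Metric.mem_ball, dist_comm] at hy
        refine hR' _ (lt_of_le_of_lt_coe (sub_dist_le_extendedGromovProduct_point (x := x)
          (R := R' + 1) (lt_of_le_of_lt_coe hw' ?_)) ?_) <;> linarith
      | infinite ζ =>
        refine Or.inr ⟨ζ, ⟨R' + δ + 1, fun v hv => hR' v ?_⟩, rfl⟩
        refine lt_of_le_of_lt_coe (sub_le_extendedGromovProduct_trans hX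
          (lt_of_le_of_lt_coe hw' ?_) hv) ?_ <;> linarith
  · exact Or.inr ⟨ξ, ⟨R, fun w hw => hw⟩, rfl⟩

theorem tendsto_nhds_infinite_iff (a : X) {ξ : GromovBoundary X} {α : Type*} {l : Filter α}
    {f : α → GromovCompactification X} :
    Tendsto f l (𝓝 (infinite ξ)) ↔
      ∀ R : ℝ, ∀ᶠ i in l, (R : EReal) < extendedGromovProduct a (infinite ξ) (f i) := by
  constructor
  · exact fun h R => h (setOf_lt_extendedGromovProduct_mem_nhds a ξ R)
  · intro h
    refine tendsto_nhds.2 fun U hU hξ => ?_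
    obtain ⟨R, hR⟩ := (isOpen_iff.1 hU).2 ξ hξ a
    exact (h R).mono fun i hi => hR _ hi

theorem le_nhds_infinite_iff (a : X) {ξ : GromovBoundary X}
    {l : Filter (GromovCompactification X)} :
    l ≤ 𝓝 (infinite ξ) ↔
      ∀ R : ℝ, ∀ᶠ w in l, (R : EReal) < extendedGromovProduct a (infinite ξ) w :=
  tendsto_nhds_infinite_iff a (f := id)

theorem denseRange_point : DenseRange (point : X → GromovCompactification X) := by
  intro z
  cases z with
  | point x => exact subset_closure ⟨x, rfl⟩
  | infinite ξ =>
    obtain ⟨u, -⟩ := (infinite ξ).exists_represents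
    choose x hx using fun n : ℕ => exists_point_lt_extendedGromovProduct (u 0) ξ n
    refine mem_closure_of_tendsto (f := fun n => point (x n)) (b := atTop) ?_
      (Eventually.of_forall fun n => ⟨x n, rfl⟩)
    refine (tendsto_nhds_infinite_iff (u 0)).2 fun R => ?_
    filter_upwards [tendsto_natCast_atTop_atTop.eventually_gt_atTop R] with n hn
    exact lt_of_le_of_lt_coe (hx n).le hn

theorem isDenseInducing_point : IsDenseInducing (point : X → GromovCompactification X) :=
  ⟨isOpenEmbedding_point.isInducing, denseRange_point⟩

instance instT2Space : T2Space (GromovCompactification X) := by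
  obtain ⟨δ, hδ, hX⟩ := exists_fourPointHyperbolic X
  have mixed : ∀ (x : X) (ξ : GromovBoundary X) (U : Ultrafilter (GromovCompactification X)),
      (U : Filter _) ≤ 𝓝 (point x) → (U : Filter _) ≤ 𝓝 (infinite ξ) → False := by
    intro x ξ U hx hξ
    have h1 : ∀ᶠ w in (U : Filter (GromovCompactification X)), w ∈ point '' Metric.ball x 1 :=
      hx (isOpenEmbedding_point.isOpenMap.image_mem_nhds (Metric.ball_mem_nhds x one_pos))
    have h2 := (le_nhds_infinite_iff x).1 hξ 1
    obtain ⟨w, ⟨y, hy, rfl⟩, hw⟩ := (h1.and h2).exists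
    have := lt_dist_of_lt_extendedGromovProduct hw
    rw [Metric.mem_ball] at hy
    linarith
  refine t2_iff_ultrafilter.2 fun {z w} U hz hw => ?_
  cases z with
  | point x =>
    cases w with
    | point y =>
      rw [← isOpenEmbedding_point.map_nhds_eq] at hz hw
      by_contra hne
      have hxy : x ≠ y := fun h => hne (congrArg _ h)
      have hd := (disjoint_map isOpenEmbedding_point.injective).2 (disjoint_nhds_nhds.2 hxy)
      exact U.neBot.ne (disjoint_self.1 (hd.mono hz hw))
    | infinite η => exact (mixed x η U hz hw).elim
  | infinite ξ =>
    cases w with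
    | point y => exact (mixed y ξ U hw hz).elim
    | infinite η =>
      obtain ⟨u, -⟩ := (infinite ξ).exists_represents
      refine congrArg _ (infinite_eq_of_forall_lt (a := u 0) fun R => ?_)
      have h1 := (le_nhds_infinite_iff (u 0)).1 hz (R + δ + 2)
      have h2 := (le_nhds_infinite_iff (u 0)).1 hw (R + δ + 2)
      obtain ⟨w, h1, h2⟩ := (h1.and h2).exists
      refine lt_of_le_of_lt_coe (sub_le_extendedGromovProduct_trans (R := R + δ + 1) hX
        (lt_of_le_of_lt_coe h1.le ?_)
        (lt_of_le_of_lt_coe (le_extendedGromovProduct_symm h2) ?_)) ?_ <;> linarith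

/-! ### Quasi-geodesic rays and compactness -/

end GromovCompactification

open GromovCompactification

/-- A quasi-geodesic ray converges to a boundary point, uniformly along its cones. -/
theorem IsIntegralQuasiGeodesicRay.exists_endpoint {k : ℝ} (hk : 1 ≤ k) {x₀ : X} {g : ℕ → X}
    (hg : IsIntegralQuasiGeodesicRay x₀ k k g) :
    ∃ ξ : GromovBoundary X, (infinite ξ).Represents g ∧ ∀ R : ℝ, ∃ M : ℕ, 1 ≤ M ∧
      ∀ x ∈ quasiGeodesicCone x₀ k k g M,
        (R : EReal) < extendedGromovProduct x₀ (infinite ξ) (point x) := by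
  obtain ⟨δ, hδ, hX⟩ := exists_fourPointHyperbolic X
  have hgg : GromovAsymptotic g g := gromovAsymptotic_of_forall x₀ fun R => by
    obtain ⟨M, hM, H⟩ := exists_le_gromovProduct_cone hX hδ hk x₀ g R
    exact ⟨M, fun i hi j hj => H _ (hg.mem_cone hM hi) _ (hg.mem_cone hM hj)⟩
  have hrep : (infinite (Quotient.mk (gromovSetoid X) ⟨g, hgg⟩)).Represents g := ⟨hgg, rfl⟩
  refine ⟨_, hrep, fun R => ?_⟩
  obtain ⟨M, hM, H⟩ := exists_le_gromovProduct_cone hX hδ hk x₀ g (R + 1 + 2 * δ)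
  refine ⟨M, hM, fun x hx => lt_of_le_of_lt_coe (S := R + 1) ?_ (by linarith)⟩
  exact le_extendedGromovProduct_of_represents hX hδ hrep (represents_point x) fun N =>
    ⟨max N M, le_max_left _ _, N, le_rfl, H _ (hg.mem_cone hM (le_max_right _ _)) _ hx⟩

/-- The limit is the endpoint of the ray whose cones contain the ultrafilter. -/
theorem exists_tendsto_infinite_of_le_cobounded [ProperSpace X] (hX : IsIntegrallyQuasiGeodesic X)
    {U : Ultrafilter X} (hU : (U : Filter X) ≤ Bornology.cobounded X) :
    ∃ ξ : GromovBoundary X, Tendsto point (U : Filter X) (𝓝 (infinite ξ)) := by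
  obtain ⟨k, hk, H⟩ := exists_ray_of_ultrafilter hX
  obtain ⟨x₀, -⟩ := U.nonempty_of_mem univ_mem
  obtain ⟨g, hg, hcone⟩ := H x₀ U hU
  obtain ⟨ξ, -, hξ⟩ := hg.exists_endpoint hk
  refine ⟨ξ, (tendsto_nhds_infinite_iff x₀).2 fun R => ?_⟩
  obtain ⟨M, hM, h⟩ := hξ R
  exact (hcone M hM).mono h

/-- An ultrafilter on K is pushed to X by approximating each boundary point. If the approximations
go to infinity, they converge to a boundary point, and so does the original ultrafilter; otherwise
it lives on a closed ball of X, compact by properness. -/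
theorem compactSpace_gromovCompactification [ProperSpace X] (hX : IsIntegrallyQuasiGeodesic X) :
    CompactSpace (GromovCompactification X) := by
  obtain ⟨δ, hδ, hδX⟩ := exists_fourPointHyperbolic X
  refine ⟨isCompact_iff_ultrafilter_le_nhds.2 fun U _ => ?_⟩
  obtain ⟨z, -⟩ := U.nonempty_of_mem univ_mem
  obtain ⟨u, -⟩ := z.exists_represents
  set x₀ := u 0
  have hs : ∀ (w : GromovCompactification X) (n : ℕ), ∃ x : X,
      (∃ ξ, w = infinite ξ ∧ ((n : ℝ) : EReal) < extendedGromovProduct x₀ w (point x)) ∨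
        w = point x := by
    intro w n
    cases w with
    | point x => exact ⟨x, Or.inr rfl⟩
    | infinite ξ =>
      obtain ⟨x, hx⟩ := exists_point_lt_extendedGromovProduct x₀ ξ n
      exact ⟨x, Or.inl ⟨ξ, rfl, hx⟩⟩
  choose s hs using hs
  -- No single approximation is fine enough for all R, so the precision is a second coordinate,
  -- forced to infinity; the first marginal of `V` is still `U`.
  let V : Ultrafilter (GromovCompactification X × ℕ) :=
    Ultrafilter.of ((U : Filter (GromovCompactification X)) ×ˢ (atTop : Filter ℕ))
  have hV : (V : Filter _) ≤ (U : Filter (GromovCompactification X)) ×ˢ (atTop : Filter ℕ) :=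
    Ultrafilter.of_le _
  have hfst : V.map Prod.fst = U :=
    Ultrafilter.eq_of_le (tendsto_fst.mono_left hV)
  have hsnd : Tendsto Prod.snd (V : Filter (GromovCompactification X × ℕ)) atTop :=
    tendsto_snd.mono_left hV
  have down : ∀ p : GromovCompactification X → Prop,
      (∀ᶠ w in (V : Filter (GromovCompactification X × ℕ)), p w.1) →
        ∀ᶠ w in (U : Filter (GromovCompactification X)), p w := by
    intro p hp
    rw [← hfst]
    exact hp
  have hlarge : ∀ R : ℝ, ∀ᶠ w in (V : Filter (GromovCompactification X × ℕ)), R < w.2 := fun R =>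
    (tendsto_natCast_atTop_atTop.comp hsnd).eventually_gt_atTop R
  by_cases hW : ((V.map fun w => s w.1 w.2 : Ultrafilter X) : Filter X) ≤ Bornology.cobounded X
  · obtain ⟨ξ, hξ⟩ := exists_tendsto_infinite_of_le_cobounded hX hW
    refine ⟨infinite ξ, trivial, (le_nhds_infinite_iff x₀).2 fun R => ?_⟩
    refine down _ ?_
    have h1 : ∀ᶠ w in (V : Filter (GromovCompactification X × ℕ)), ((R + δ + 1 : ℝ) : EReal) <
        extendedGromovProduct x₀ (infinite ξ) (point (s w.1 w.2)) :=
      (tendsto_nhds_infinite_iff x₀).1 hξ (R + δ + 1)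
    have h3 : ∀ᶠ w in (V : Filter (GromovCompactification X × ℕ)),
        R + δ + 2 < dist (s w.1 w.2) x₀ :=
      ((Metric.tendsto_dist_right_cobounded_atTop x₀).mono_left hW).eventually_gt_atTop _
    filter_upwards [h1, h3, hlarge (R + δ + 2)] with w hw1 hw3 hw2
    have h2 : ((R + δ + 2 : ℝ) : EReal) ≤
        extendedGromovProduct x₀ (point (s w.1 w.2)) w.1 := by
      obtain ⟨w, n⟩ := w
      dsimp only at hw1 hw2 hw3 ⊢
      rcases hs w n with ⟨η, -, hη⟩ | h
      · exact le_extendedGromovProduct_symm (lt_of_le_of_lt_coe hη.le hw2)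
      · generalize s w n = x at *
        rw [h]
        exact le_extendedGromovProduct_point_self hw3.le
    exact lt_of_le_of_lt_coe (sub_le_extendedGromovProduct_trans hδX hw1
      (lt_of_le_of_lt_coe h2 (by linarith))) (by linarith)
  · obtain ⟨S, hS, hSW⟩ := Filter.not_le.1 hW
    obtain ⟨r, hr⟩ := (Bornology.isBounded_compl_iff.2 hS).subset_closedBall x₀
    have h1 : ∀ᶠ w in (V : Filter (GromovCompactification X × ℕ)), s w.1 w.2 ∈ Sᶜ :=
      Ultrafilter.compl_mem_iff_notMem.2 hSW
    have h2 : ∀ᶠ w in (U : Filter (GromovCompactification X)),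
        w ∈ point '' Metric.closedBall x₀ r := by
      refine down _ ?_
      filter_upwards [h1, hlarge r] with w hw1 hw2
      have hw3 := hr hw1
      rcases hs w.1 w.2 with ⟨η, -, hη⟩ | h
      · have := lt_dist_of_lt_extendedGromovProduct hη
        rw [Metric.mem_closedBall] at hw3
        linarith
      · exact ⟨_, hw3, h.symm⟩
    obtain ⟨z, -, hz⟩ := ((isCompact_closedBall x₀ r).image
      isOpenEmbedding_point.continuous).ultrafilter_le_nhds U (le_principal_iff.2 h2)
    exact ⟨z, trivial, hz⟩

end Compactification

open GromovCompactification

/-! ### Slowly oscillating functions and continuous extension. -/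

section SlowlyOscillating

variable {X : Type*} [MetricSpace X]

/-- Small oscillation on cones makes `f ∘ g` Cauchy, and every filter trapped in the cones inherits
its limit. -/
theorem IsGeometricallySlowlyOscillating.exists_tendsto {f : X → ℂ}
    (hf : IsGeometricallySlowlyOscillating f) {k : ℝ} (hk : 1 ≤ k) {x₀ : X} {g : ℕ → X}
    (hg : IsIntegralQuasiGeodesicRay x₀ k k g) :
    ∃ c : ℂ, Tendsto (f ∘ g) atTop (𝓝 c) ∧ ∀ l : Filter X,
      (∀ m : ℕ, 1 ≤ m → ∀ᶠ x in l, x ∈ quasiGeodesicCone x₀ k k g m) → Tendsto f l (𝓝 c) := by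
  have close : ∀ ε : ℝ, 0 < ε → ∃ m : ℕ, 1 ≤ m ∧ ∀ x ∈ quasiGeodesicCone x₀ k k g m,
      ∀ y ∈ quasiGeodesicCone x₀ k k g m, dist (f x) (f y) < ε := by
    intro ε hε
    obtain ⟨m, hm⟩ := hf.close hk hg hε
    refine ⟨max 1 m, le_max_left _ _, fun x hx y hy => ?_⟩
    rw [dist_eq_norm]
    exact hm _ (le_max_right _ _) x hx y hy
  have hc : CauchySeq (f ∘ g) := by
    refine Metric.cauchySeq_iff.2 fun ε hε => ?_
    obtain ⟨m, hm, H⟩ := close ε hε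
    exact ⟨m, fun i hi j hj => H _ (hg.mem_cone hm hi) _ (hg.mem_cone hm hj)⟩
  obtain ⟨c, hc⟩ := cauchySeq_tendsto_of_complete hc
  refine ⟨c, hc, fun l hl => Metric.tendsto_nhds.2 fun ε hε => ?_⟩
  obtain ⟨m, hm, H⟩ := close (ε / 2) (by positivity)
  obtain ⟨i, hi, him⟩ := ((Metric.tendsto_nhds.1 hc (ε / 2) (by positivity)).and
    (eventually_ge_atTop m)).exists
  filter_upwards [hl m hm] with x hx
  have h1 := H x hx _ (hg.mem_cone hm him)
  have h2 := dist_triangle (f x) (f (g i)) c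
  simp only [Function.comp_apply] at hi
  linarith

theorem tendsto_atTop_of_tendsto_cobounded {ι : Type*} {l : Filter ι} {g : ℕ → X} {i : ι → ℕ}
    (h : Tendsto (fun n => g (i n)) l (Bornology.cobounded X)) : Tendsto i l atTop := by
  refine tendsto_atTop.2 fun m => ?_
  have hb : Bornology.IsBounded (g '' Set.Iio m) := ((Set.finite_Iio m).image g).isBounded
  filter_upwards [h hb.compl] with n hn
  by_contra! hc
  exact hn ⟨i n, hc, rfl⟩

variable [GromovHyperbolicSpace X]

theorem comap_point_nhds_infinite_le_cobounded (ξ : GromovBoundary X) :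
    comap (point : X → GromovCompactification X) (𝓝 (infinite ξ)) ≤ Bornology.cobounded X := by
  obtain ⟨u, -⟩ := (infinite ξ).exists_represents
  have h := (tendsto_nhds_infinite_iff (u 0)).1
    (tendsto_comap (f := (point : X → GromovCompactification X)) (x := 𝓝 (infinite ξ)))
  have h2 : Tendsto (fun x => dist x (u 0)) (comap point (𝓝 (infinite ξ))) atTop :=
    tendsto_atTop.2 fun R => (h R).mono fun x hx => (lt_dist_of_lt_extendedGromovProduct hx).le
  exact (Metric.tendsto_dist_right_atTop_iff (f := id) (u 0)).1 h2

/-- Geometrically slowly oscillating functions have equal limits along asymptotic rays. -/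
theorem IsGeometricallySlowlyOscillating.eq_of_asymptotic {f : X → ℂ}
    (hf : IsGeometricallySlowlyOscillating f) {k : ℝ} (hk : 1 ≤ k) {x₀ : X} {g g' : ℕ → X}
    (hg : IsIntegralQuasiGeodesicRay x₀ k k g) (hg' : IsIntegralQuasiGeodesicRay x₀ k k g')
    (h : GromovAsymptotic g g') {c c' : ℂ} (hc : Tendsto (f ∘ g) atTop (𝓝 c))
    (hc' : Tendsto (f ∘ g') atTop (𝓝 c')) : c = c' := by
  obtain ⟨δ, hδ, hX⟩ := exists_fourPointHyperbolic X
  obtain ⟨C, hC⟩ := exists_dist_le_of_asymptotic_rays hX hδ hk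
  have h1 := hC x₀ g g' hg hg' fun R => by
    obtain ⟨N, hN⟩ := h.exists_forall_le x₀ R
    exact ⟨max 1 N, max 1 N, le_max_left _ _, le_max_left _ _,
      hN _ (le_max_right _ _) _ (le_max_right _ _)⟩
  choose i j hij hi using fun n : ℕ => h1 n n.cast_nonneg
  have hgi : Tendsto (fun n => g (i n)) atTop (Bornology.cobounded X) :=
    (Metric.tendsto_dist_right_atTop_iff x₀).1
      (tendsto_atTop_mono hi tendsto_natCast_atTop_atTop)
  have hgj : Tendsto (fun n => g' (j n)) atTop (Bornology.cobounded X) := by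
    refine (Metric.tendsto_dist_right_atTop_iff x₀).1 (tendsto_atTop_mono (fun n => ?_)
      (tendsto_atTop_add_const_right _ (-C) tendsto_natCast_atTop_atTop))
    linarith [hi n, hij n, dist_triangle (g (i n)) (g' (j n)) x₀]
  have h2 := hf.slowlyOscillating _ (fun n => g' (j n)) hgi
    ⟨|C| + 1, by positivity, fun n => by linarith [hij n, le_abs_self C]⟩
  have h3 := hc.comp (tendsto_atTop_of_tendsto_cobounded hgi)
  have h4 := hc'.comp (tendsto_atTop_of_tendsto_cobounded hgj)
  have h5 := tendsto_nhds_unique h2 (h3.sub h4).norm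
  exact sub_eq_zero.1 (norm_eq_zero.1 h5.symm)

variable [ProperSpace X]

/-- Each ultrafilter approaching ξ is captured by a ray, which ends at ξ because K is Hausdorff. All
these rays are asymptotic, so `f` has one common limit. -/
theorem IsGeometricallySlowlyOscillating.exists_tendsto_comap_point
    (hX : IsIntegrallyQuasiGeodesic X) {f : X → ℂ} (hf : IsGeometricallySlowlyOscillating f)
    (z : GromovCompactification X) : ∃ c, Tendsto f (comap point (𝓝 z)) (𝓝 c) := by
  cases z with
  | point x =>
    rw [← isDenseInducing_point.nhds_eq_comap]
    exact ⟨f x, hf.continuous.continuousAt⟩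
  | infinite ξ =>
    obtain ⟨k, hk, H⟩ := exists_ray_of_ultrafilter hX
    obtain ⟨u, -⟩ := (infinite ξ).exists_represents
    have ray : ∀ U : Ultrafilter X, (U : Filter X) ≤ comap point (𝓝 (infinite ξ)) →
        ∃ (g : ℕ → X) (c : ℂ), IsIntegralQuasiGeodesicRay (u 0) k k g ∧
          (infinite ξ).Represents g ∧ Tendsto (f ∘ g) atTop (𝓝 c) ∧ Tendsto f U (𝓝 c) := by
      intro U hU
      obtain ⟨g, hg, hcone⟩ := H (u 0) U (hU.trans (comap_point_nhds_infinite_le_cobounded ξ))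
      obtain ⟨η, hη, hηM⟩ := hg.exists_endpoint hk
      obtain ⟨c, hc, hcU⟩ := hf.exists_tendsto hk hg
      have h1 : Tendsto point (U : Filter X) (𝓝 (infinite η)) :=
        (tendsto_nhds_infinite_iff (u 0)).2 fun R => by
          obtain ⟨M, hM, h⟩ := hηM R
          exact (hcone M hM).mono h
      have h2 : Tendsto point (U : Filter X) (𝓝 (infinite ξ)) := tendsto_comap.mono_left hU
      rw [tendsto_nhds_unique h1 h2] at hη
      exact ⟨g, c, hg, hη, hc, hcU _ hcone⟩
    -- Density of X provides one ultrafilter, whose ray supplies the candidate limit.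
    have := isDenseInducing_point.comap_nhds_neBot (infinite ξ)
    obtain ⟨g, c, hg, hξg, hc, -⟩ := ray _ (Ultrafilter.of_le (comap point (𝓝 (infinite ξ))))
    refine ⟨c, (tendsto_iff_ultrafilter _ _ _).2 fun U hU => ?_⟩
    obtain ⟨g', c', hg', hξg', hc', hU'⟩ := ray U hU
    rwa [hf.eq_of_asymptotic hk hg hg' (hξg.asymptotic hξg') hc hc']

theorem IsGeometricallySlowlyOscillating.exists_continuousMap
    (hX : IsIntegrallyQuasiGeodesic X) {f : X → ℂ} (hf : IsGeometricallySlowlyOscillating f) :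
    ∃ F : C(GromovCompactification X, ℂ), ∀ x : X, F (point x) = f x :=
  ⟨⟨isDenseInducing_point.extend f,
    isDenseInducing_point.continuous_extend (hf.exists_tendsto_comap_point hX)⟩,
    isDenseInducing_point.extend_eq hf.continuous⟩

/-- Compactness gives boundedness. Sequences going to infinity at bounded distance from each other
have the same boundary limit along every ultrafilter, and the cones of a ray enter every
neighbourhood of its endpoint. -/
theorem ContinuousMap.isGeometricallySlowlyOscillating
    (hX : IsIntegrallyQuasiGeodesic X) (F : C(GromovCompactification X, ℂ)) :
    IsGeometricallySlowlyOscillating fun x : X => F (point x) := by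
  have := compactSpace_gromovCompactification hX
  refine ⟨F.continuous.comp isOpenEmbedding_point.continuous, ?_, ?_, ?_⟩
  · obtain ⟨C, hC⟩ := isCompact_univ.exists_bound_of_continuousOn F.continuous.continuousOn
    exact ⟨C, fun x => hC _ trivial⟩
  · rintro x y hx ⟨M, -, hM⟩
    refine (tendsto_iff_ultrafilter _ _ _).2 fun U hU => ?_
    obtain ⟨ξ, hξ⟩ := exists_tendsto_infinite_of_le_cobounded hX (U := U.map x)
      (hx.mono_left hU)
    have h1 : Tendsto (fun n => point (x n)) (U : Filter ℕ) (𝓝 (infinite ξ)) := hξ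
    have h2 : Tendsto (fun n => point (y n)) (U : Filter ℕ) (𝓝 (infinite ξ)) := by
      refine (tendsto_nhds_infinite_iff (x 0)).2 fun R => ?_
      filter_upwards [(tendsto_nhds_infinite_iff (x 0)).1 h1 (R + M)] with n hn
      refine lt_of_le_of_lt_coe (sub_dist_le_extendedGromovProduct_point hn) ?_
      linarith [hM n]
    have h3 := (((F.continuous.tendsto _).comp h1).sub ((F.continuous.tendsto _).comp h2)).norm
    simpa using h3
  · intro ε hε k x₀ g hk hg
    refine geometric_of_close (fun ε hε => ?_) ε hε
    obtain ⟨ξ, -, hξ⟩ := hg.exists_endpoint hk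
    have h1 : F ⁻¹' Metric.ball (F (infinite ξ)) (ε / 2) ∈ 𝓝 (infinite ξ) :=
      F.continuous.continuousAt (Metric.ball_mem_nhds _ (by positivity))
    obtain ⟨U, hU, hUo, hξU⟩ := mem_nhds_iff.1 h1
    obtain ⟨R, hR⟩ := (GromovCompactification.isOpen_iff.1 hUo).2 ξ hξU x₀
    obtain ⟨M, hM, H⟩ := hξ R
    refine ⟨M, hM, fun x hx y hy => ?_⟩
    have hx' := hU (hR _ (H x hx))
    have hy' := hU (hR _ (H y hy))
    rw [Set.mem_preimage, Metric.mem_ball] at hx' hy'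
    rw [← dist_eq_norm]
    linarith [dist_triangle_right (F (point x)) (F (point y)) (F (infinite ξ))]

theorem isGeometricallySlowlyOscillating_iff (hX : IsIntegrallyQuasiGeodesic X) {f : X → ℂ} :
    IsGeometricallySlowlyOscillating f ↔
      ∃ F : C(GromovCompactification X, ℂ), ∀ x : X, F (point x) = f x := by
  refine ⟨fun hf => hf.exists_continuousMap hX, ?_⟩
  rintro ⟨F, hF⟩
  obtain rfl : (fun x => F (point x)) = f := funext hF
  exact F.isGeometricallySlowlyOscillating hX

/-! ### The homeomorphism -/

/-- Restriction of continuous functions from the Gromov compactification to `X`. -/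
noncomputable def restrictToPoints (hX : IsIntegrallyQuasiGeodesic X) :
    C(GromovCompactification X, ℂ) →ₐ[ℂ] quasiGeodesicAlgebra X where
  toFun F :=
    ⟨.ofNormedAddCommGroup (fun x => F (point x)) (F.isGeometricallySlowlyOscillating hX).continuous
      (F.isGeometricallySlowlyOscillating hX).bounded.choose
      (F.isGeometricallySlowlyOscillating hX).bounded.choose_spec,
      F.isGeometricallySlowlyOscillating hX⟩
  map_one' := rfl
  map_mul' _ _ := rfl
  map_zero' := rfl
  map_add' _ _ := rfl
  commutes' _ := rfl

theorem restrictToPoints_bijective (hX : IsIntegrallyQuasiGeodesic X) :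
    Function.Bijective (restrictToPoints hX) := by
  constructor
  · intro F G h
    refine ContinuousMap.coe_injective (denseRange_point.equalizer F.continuous G.continuous ?_)
    funext x
    have := congrArg (fun f : quasiGeodesicAlgebra X => (f : X →ᵇ ℂ) x) h
    exact this
  · intro f
    obtain ⟨F, hF⟩ := IsGeometricallySlowlyOscillating.exists_continuousMap hX f.2
    exact ⟨F, Subtype.ext (BoundedContinuousFunction.ext hF)⟩

/-- Restriction to `X` is an isomorphism between the continuous functions on the Gromov
compactification and the geometrically slowly oscillating functions. -/
noncomputable def restrictEquiv (hX : IsIntegrallyQuasiGeodesic X) :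
    C(GromovCompactification X, ℂ) ≃ₐ[ℂ] quasiGeodesicAlgebra X :=
  AlgEquiv.ofBijective (restrictToPoints hX) (restrictToPoints_bijective hX)

theorem restrictEquiv_symm_apply_point (hX : IsIntegrallyQuasiGeodesic X)
    (f : quasiGeodesicAlgebra X) (x : X) :
    (restrictEquiv hX).symm f (point x) = (f : X →ᵇ ℂ) x := by
  conv_rhs => rw [← (restrictEquiv hX).apply_symm_apply f]
  rfl

theorem norm_restrictEquiv_symm_apply_le (hX : IsIntegrallyQuasiGeodesic X)
    (f : quasiGeodesicAlgebra X) (z : GromovCompactification X) :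
    ‖(restrictEquiv hX).symm f z‖ ≤ ‖f‖ := by
  refine denseRange_point.induction_on z
    (isClosed_le ((restrictEquiv hX).symm f).continuous.norm continuous_const) fun x => ?_
  rw [restrictEquiv_symm_apply_point]
  exact (f : X →ᵇ ℂ).norm_coe_le_norm x

/-- The character of `C_QG(X)` given by evaluation at a point of the Gromov compactification. -/
noncomputable def evalCharacter (hX : IsIntegrallyQuasiGeodesic X)
    (z : GromovCompactification X) : QuasiGeodesicCompactification X :=
  ⟨StrongDual.toWeakDual (LinearMap.mkContinuous
    { toFun := fun f => (restrictEquiv hX).symm f z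
      map_add' := fun f g => by rw [map_add]; rfl
      map_smul' := fun c f => by rw [map_smul]; rfl } 1
    fun f => by rw [one_mul]; exact norm_restrictEquiv_symm_apply_le hX f z), by
    refine ⟨fun h => ?_, fun f g => ?_⟩
    · have h1 : (restrictEquiv hX).symm 1 z = 0 :=
        DFunLike.congr_fun h (1 : quasiGeodesicAlgebra X)
      rw [map_one] at h1
      exact one_ne_zero (α := ℂ) h1
    · show (restrictEquiv hX).symm (f * g) z =
        (restrictEquiv hX).symm f z * (restrictEquiv hX).symm g z
      rw [map_mul]
      rfl⟩

theorem evalCharacter_apply (hX : IsIntegrallyQuasiGeodesic X) (z : GromovCompactification X)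
    (f : quasiGeodesicAlgebra X) : evalCharacter hX z f = (restrictEquiv hX).symm f z :=
  rfl

theorem evalCharacter_point (hX : IsIntegrallyQuasiGeodesic X) (x : X) :
    evalCharacter hX (point x) = toQuasiGeodesicCompactification x :=
  WeakDual.CharacterSpace.ext fun f => restrictEquiv_symm_apply_point hX f x

theorem continuous_evalCharacter (hX : IsIntegrallyQuasiGeodesic X) :
    Continuous (evalCharacter hX) :=
  Continuous.subtype_mk (WeakDual.continuous_of_continuous_eval fun f =>
    ((restrictEquiv hX).symm f).continuous) _

/-- Characters of C(K) are the points of the compact Hausdorff space K. They transfer through a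
purely algebraic isomorphism because algebra homomorphisms C(K) → ℂ are automatically continuous. -/
theorem evalCharacter_bijective (hX : IsIntegrallyQuasiGeodesic X) :
    Function.Bijective (evalCharacter hX) := by
  have := compactSpace_gromovCompactification hX
  have hb := WeakDual.CharacterSpace.continuousMapEval_bijective
    (X := GromovCompactification X) (𝕜 := ℂ)
  constructor
  · intro z w h
    refine hb.1 (WeakDual.CharacterSpace.ext fun F => ?_)
    have h1 := DFunLike.congr_fun h (restrictEquiv hX F)
    rw [evalCharacter_apply, evalCharacter_apply, AlgEquiv.symm_apply_apply] at h1
    exact h1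
  · intro χ
    obtain ⟨z, hz⟩ := hb.2 (WeakDual.CharacterSpace.equivAlgHom.symm
      ((WeakDual.CharacterSpace.toAlgHom χ).comp
        (restrictEquiv hX : C(GromovCompactification X, ℂ) →ₐ[ℂ] quasiGeodesicAlgebra X)))
    refine ⟨z, WeakDual.CharacterSpace.ext fun f => ?_⟩
    have h1 := DFunLike.congr_fun hz ((restrictEquiv hX).symm f)
    rw [WeakDual.CharacterSpace.equivAlgHom_symm_coe] at h1
    refine h1.trans ?_
    show χ (restrictEquiv hX ((restrictEquiv hX).symm f)) = χ f
    rw [AlgEquiv.apply_symm_apply]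

end SlowlyOscillating

theorem proposition4p14 {X : Type*} [MetricSpace X] [ProperSpace X] [GromovHyperbolicSpace X]
    (hX : IsIntegrallyQuasiGeodesic X) :
    (∃ (Φ : GromovCompactification X ≃ₜ QuasiGeodesicCompactification X)
        (φ : GromovBoundary X ≃ₜ quasiGeodesicBoundary X),
      (∀ x : X, Φ (.point x) = toQuasiGeodesicCompactification x) ∧
        ∀ ξ : GromovBoundary X, Φ (.infinite ξ) = (φ ξ : QuasiGeodesicCompactification X)) ∧
    ∀ f : X → ℂ, IsGeometricallySlowlyOscillating f ↔
      ∃ F : C(GromovCompactification X, ℂ), ∀ x : X, F (.point x) = f x := by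
  refine ⟨?_, fun f => isGeometricallySlowlyOscillating_iff hX⟩
  have := compactSpace_gromovCompactification hX
  -- A continuous bijection from a compact space onto a Hausdorff space needs no separate proof of a
  -- continuous inverse.
  let Φ : GromovCompactification X ≃ₜ QuasiGeodesicCompactification X :=
    Continuous.homeoOfEquivCompactToT2
      (f := Equiv.ofBijective (evalCharacter hX) (evalCharacter_bijective hX))
      (continuous_evalCharacter hX)
  have hΦ : ∀ x : X, Φ (point x) = toQuasiGeodesicCompactification x := evalCharacter_point hX
  have he : IsEmbedding fun ξ : GromovBoundary X => Φ (infinite ξ) :=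
    Φ.isEmbedding.comp isEmbedding_infinite
  have hrange : Set.range (fun ξ : GromovBoundary X => Φ (infinite ξ)) =
      quasiGeodesicBoundary X := by
    ext χ
    constructor
    · rintro ⟨ξ, rfl⟩ ⟨x, hx⟩
      cases Φ.injective ((hΦ x).trans hx)
    · intro hχ
      obtain ⟨z, rfl⟩ := Φ.surjective χ
      cases z with
      | point x => exact (hχ ⟨x, (hΦ x).symm⟩).elim
      | infinite ξ => exact ⟨ξ, rfl⟩
  exact ⟨Φ, he.toHomeomorph.trans (Homeomorph.setCongr hrange), hΦ, fun ξ => rfl⟩
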